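/- Fix an algebraic closure $\overline{\mathbb Q}$ of $\mathbb Q$; all fields are subfields of $\overline{\mathbb Q}$. For a number field $K$ let $\Delta_K$ be its absolute discriminant, and for a number field $F$ let $F^{(g)}\subseteq\overline{\mathbb Q}$ be the Galois closure of $F$ over $\mathbb Q$. Let $H$ denote the absolute non-logarithmic Weil height on $\overline{\mathbb Q}$. A set $\mathcal A\subseteq\overline{\mathbb Q}$ has the Northcott property if for every real $X>0$ there are only finitely many $\alpha\in\mathcal A$ with $H(\alpha)\le X$. Let $F_1,F_2,F_3,\dots$ be a sequence of extension fields of $\mathbb Q$ with $[F_i:\mathbb Q]\le 3$ for all $i\geq 1$, such that for each integer $i>1$ there is a prime number $p_i$ with $p_i\mid\Delta_{F_i}$ and $p_i\nmid\Delta_{F_j}$ for $1\le j<i$. Suppose further that for each $i>1$ at least one of the following conditions holds: (a) $F_i/\mathbb Q$ is Galois; (b) $F_i=\mathbb Q(\alpha)$ for some $\alpha$ with $\alpha^3\in\mathbb Q$; (c) $F_i=\mathbb Q(\alpha)$ for some algebraic integer $\alpha$ such that $2\nmid\operatorname{ord}_{p_i}\operatorname{Disc}(D_\alpha)$, where $D_\alpha\in\mathbb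 Z[x]$ is the monic minimal polynomial of $\alpha$; (d) $F_i=\mathbb Q(\alpha)$ for a root $\alpha$ of a polynomial of the form $x^3+a_0c^3x^l+b_0^lc^3$ with $l\in\{1,2\}$ and integers $a_0,b_0,c$ satisfying $\gcd(2a_0c,3b_0)=1$. Then the compositum of $F_1^{(g)},F_2^{(g)},F_3^{(g)},\dots$ has the Northcott property. -/

import Mathlib

open Polynomial IntermediateField

/-- A set `A` of algebraic numbers has the Northcott property if for every real `X` it contains
only finitely many elements of absolute (non-logarithmic) Weil height at most `X`. -/
def HasNorthcottProperty (A : Set (AlgebraicClosure ℚ)) : Prop :=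
  Northcott fun α : A ↦ NumberField.absMulHeight₁ (α : AlgebraicClosure ℚ)

/-- `F` is generated over `ℚ` by an element whose cube is rational. -/
def IsPureCubicType (F : IntermediateField ℚ (AlgebraicClosure ℚ)) : Prop :=
  ∃ α : AlgebraicClosure ℚ, F = ℚ⟮α⟯ ∧ ∃ q : ℚ, α ^ 3 = algebraMap ℚ (AlgebraicClosure ℚ) q

/-- `F` is generated over `ℚ` by an algebraic integer whose minimal polynomial over `ℤ` has
a discriminant of odd `p`-adic valuation. -/
def HasOddDiscrGenerator (F : IntermediateField ℚ (AlgebraicClosure ℚ)) (p : ℕ) : Prop :=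
  ∃ α : AlgebraicClosure ℚ, IsIntegral ℤ α ∧ F = ℚ⟮α⟯ ∧
    ¬ 2 ∣ padicValInt p (minpoly ℤ α).discr

/-- `F` is generated over `ℚ` by a root of a trinomial `x³ + a₀ c³ xˡ + b₀ˡ c³` with `l ∈ {1, 2}`
and integers `a₀, b₀, c` such that `gcd (2 a₀ c, 3 b₀) = 1`. -/
def IsOsadaTrinomialType (F : IntermediateField ℚ (AlgebraicClosure ℚ)) : Prop :=
  ∃ (α : AlgebraicClosure ℚ) (a₀ b₀ c : ℤ) (l : ℕ), F = ℚ⟮α⟯ ∧ (l = 1 ∨ l = 2) ∧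
    Int.gcd (2 * a₀ * c) (3 * b₀) = 1 ∧
    aeval α (X ^ 3 + C (a₀ * c ^ 3) * X ^ l + C (b₀ ^ l * c ^ 3) : ℤ[X]) = 0

/-! Build a tower of number fields starting with `ℚ(ζ₃)` and adjoining one Galois closure at a time.
Let `L / K` be the step adding the conjugates of `F = F_i`, and let `p = p_i`. If every `α ∈ L`
outside `K` satisfies `p ≤ (2 * H(α)²) ^ 216`, then, the `p_i` being distinct and so tending to
infinity, elements of height at most `X` all lie in one fixed layer. There Northcott's theorem for
number fields applies.

For the height bound, note that `p` is large, hence unramified in `K`, so each inertia group `I`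
above `p` lies in `H = Gal(L/K)`, a group of order at most 6. Suppose the `H`-conjugates of `I`
generate `H`. Since `α` is moved by `H`, at each place `w` above `p` some `g ∈ I` moves some
conjugate `h α`, and `h α - g (h α)` is `w`-adically small: its sixth power is at most `|p|_w` times
the trivial bound. The product formula for the product of all nonzero differences of `H`-conjugates
of `α` then bounds `p ^ [L : ℚ]`, and the degree cancels on taking roots
(`le_absMulHeight₁_of_notMem`).

Conditions (a)-(d) supply the normal generation (`inertia_normallyGenerates`). In cases (a) and (b),
with `ζ₃ ∈ K`, the group `H` has order at most 3 and the nontrivial `I` is all of it. In (c) and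
(d), `H` embeds in `S₃` and `I` contains a transposition, whose conjugates generate `H`. -/

namespace NumberField

/-! ### Heights under extension of number fields -/

open Height

/-- A product over the infinite places, weighted by multiplicity, is a product over the complex
embeddings. -/
lemma InfinitePlace.prod_pow_mult_eq_prod_embeddings {K : Type*} [Field K] [NumberField K]
    (g : InfinitePlace K → ℝ) :
    ∏ v, g v ^ v.mult = ∏ φ : K →+* ℂ, g (InfinitePlace.mk φ) := by
  classical
  rw [← Finset.prod_fiberwise Finset.univ InfinitePlace.mk (fun φ : K →+* ℂ ↦ g (.mk φ))]
  refine Finset.prod_congr rfl fun w _ ↦ ?_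
  rw [Finset.prod_congr rfl (g := fun _ ↦ g w)
    fun φ hφ ↦ by rw [(Finset.mem_filter.mp hφ).2], Finset.prod_const,
    InfinitePlace.card_filter_mk_eq]

/-- The height of `a / n` in terms of the archimedean absolute values of the integers `a`, `n` and
of the norm of the ideal they generate. -/
lemma absNorm_mul_mulHeight₁_div {K : Type*} [Field K] [NumberField K] (a : 𝓞 K) {n : ℕ}
    (hn : n ≠ 0) :
    (Ideal.span {a, (n : 𝓞 K)}).absNorm * mulHeight₁ ((a : K) / n) =
      ∏ φ : K →+* ℂ, max ‖φ a‖ n := by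
  have hn' : (n : K) ≠ 0 := mod_cast hn
  have hv (i : Fin 2) : (![(a : K), n] i : K) = ((![a, n] i : 𝓞 K) : K) := by fin_cases i <;> rfl
  have h2 : Ideal.span {a, (n : 𝓞 K)} = Ideal.span (Set.range ![a, (n : 𝓞 K)]) := by
    simp [Matrix.range_cons, Set.pair_comm]
  have h1 := absNorm_mul_finprod_finitePlace_eq_one (K := K) (x := ![a, (n : 𝓞 K)])
    (by simp [hn])
  rw [mulHeight₁_div_eq_mulHeight, NumberField.mulHeight_eq (by simp [hn']),
    InfinitePlace.prod_pow_mult_eq_prod_embeddings, h2, mul_left_comm]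
  simp_rw [hv] at *
  rw [h1, mul_one]
  refine Finset.prod_congr rfl fun φ _ ↦ ?_
  refine le_antisymm (ciSup_le fun i ↦ ?_) (max_le ?_ ?_)
  · fin_cases i <;> simp
  · exact (le_of_eq (by simp)).trans (Finite.le_ciSup _ (0 : Fin 2))
  · exact (le_of_eq (by simp)).trans (Finite.le_ciSup _ (1 : Fin 2))

lemma prod_embeddings_comp_algebraMap {K L : Type*} [Field K] [NumberField K] [Field L]
    [NumberField L] [Algebra K L] (g : (K →+* ℂ) → ℝ) :
    ∏ φ : L →+* ℂ, g (φ.comp (algebraMap K L)) = (∏ ψ, g ψ) ^ Module.finrank K L := by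
  classical
  rw [← Finset.prod_fiberwise Finset.univ (fun φ : L →+* ℂ ↦ φ.comp (algebraMap K L)),
    ← Finset.prod_pow]
  refine Finset.prod_congr rfl fun ψ _ ↦ ?_
  rw [Finset.prod_congr rfl (g := fun _ ↦ g ψ)
    fun φ hφ ↦ by rw [(Finset.mem_filter.mp hφ).2], Finset.prod_const]
  congr 1
  let := ψ.toAlgebra
  rw [← AlgHom.card K L ℂ, ← Finset.card_univ]
  symm
  refine Finset.card_bij (fun f _ ↦ f.toRingHom) (fun f _ ↦ ?_) (fun f _ g _ h ↦ ?_)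
    (fun φ hφ ↦ ?_)
  · simp only [Finset.mem_filter, Finset.mem_univ, true_and]
    exact f.comp_algebraMap
  · exact AlgHom.coe_ringHom_injective h
  · exact ⟨⟨φ, fun x ↦ RingHom.congr_fun (Finset.mem_filter.mp hφ).2 x⟩, Finset.mem_univ _, rfl⟩

/-- Functoriality of the relative height under extensions of number fields. -/
lemma mulHeight₁_algebraMap {K L : Type*} [Field K] [NumberField K] [Field L]
    [NumberField L] [Algebra K L] (x : K) :
    mulHeight₁ (algebraMap K L x) = mulHeight₁ x ^ Module.finrank K L := by
  -- With `x = a / n`, no place-by-place comparison is needed: the finite part of the height is the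
  -- norm of the ideal `(a, n)`, which becomes its `[L : K]`-th power in `L`, and each embedding of
  -- `K` has `[L : K]` extensions.
  obtain ⟨n, hn, a, hna, -⟩ := exists_nat_ne_zero_exists_integer_mul_eq_and_absNorm_span_eq_pow x
  have hn' : (n : K) ≠ 0 := mod_cast hn
  obtain rfl : x = a / n := by rw [← hna, mul_div_cancel_left₀ _ hn']
  have hK := absNorm_mul_mulHeight₁_div a hn
  have hL := absNorm_mul_mulHeight₁_div (algebraMap (𝓞 K) (𝓞 L) a) hn
  have hspan : Ideal.span {algebraMap (𝓞 K) (𝓞 L) a, (n : 𝓞 L)} =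
      (Ideal.span {a, (n : 𝓞 K)}).map (algebraMap (𝓞 K) (𝓞 L)) := by
    simp [Ideal.map_span, Set.image_pair]
  have hfr : Module.finrank (𝓞 K) (𝓞 L) = Module.finrank K L :=
    (IsFractionRing.finrank_eq (𝓞 K) K (𝓞 L) L).symm
  have hprod := prod_embeddings_comp_algebraMap (L := L) (fun ψ : K →+* ℂ ↦ max ‖ψ a‖ (n : ℝ))
  have hne : ((Ideal.span {a, (n : 𝓞 K)}).absNorm : ℝ) ≠ 0 := by
    rw [Nat.cast_ne_zero, Ne, Ideal.absNorm_eq_zero_iff, Ideal.span_eq_bot]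
    intro h
    exact hn (by simpa using h (n : 𝓞 K) (by simp))
  rw [hspan, Ideal.absNorm_algebraMap, hfr] at hL
  refine mul_left_cancel₀ (pow_ne_zero (Module.finrank K L) hne) ?_
  rw [← mul_pow, hK, ← hprod]
  have hc : ((algebraMap (𝓞 K) (𝓞 L) a : 𝓞 L) : L) = algebraMap K L a := rfl
  rw [hc] at hL
  push_cast at hL
  simpa using hL

lemma mulHeight₁_ringHom_pow {K L : Type*} [Field K] [NumberField K] [Field L]
    [NumberField L] (f : K →+* L) (x : K) :
    mulHeight₁ (f x) ^ Module.finrank ℚ K = mulHeight₁ x ^ Module.finrank ℚ L := by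
  let := f.toAlgebra
  rw [show f x = algebraMap K L x from rfl, mulHeight₁_algebraMap, ← pow_mul, mul_comm,
    Module.finrank_mul_finrank]

lemma mulHeight₁_algEquiv {L : Type*} [Field L] [NumberField L] (σ : L ≃ₐ[ℚ] L) (x : L) :
    mulHeight₁ (σ x) = mulHeight₁ x :=
  (pow_left_inj₀ (mulHeight₁_nonneg _) (mulHeight₁_nonneg _)
    (Module.finrank_pos (R := ℚ) (M := L)).ne').mp
    (mulHeight₁_ringHom_pow σ.toRingEquiv.toRingHom x)

/-- The absolute height is normalised in `ℚ(x)`; functoriality along `ℚ(x) ⊆ L` lets it be computed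
in any layer. -/
lemma absMulHeight₁_pow_finrank {E : Type*} [Field E] [CharZero E] [Algebra.IsAlgebraic ℚ E]
    (L : IntermediateField ℚ E) [NumberField L] (x : L) :
    absMulHeight₁ (x : E) ^ Module.finrank ℚ L = mulHeight₁ x := by
  have hx : IsIntegral ℚ (x : E) := Algebra.IsIntegral.isIntegral _
  have : FiniteDimensional ℚ ℚ⟮(x : E)⟯ := adjoin.finiteDimensional hx
  have : NumberField ℚ⟮(x : E)⟯ := {}
  have hle : ℚ⟮(x : E)⟯ ≤ L := adjoin_simple_le_iff.mpr x.2
  have h := mulHeight₁_ringHom_pow (IntermediateField.inclusion hle).toRingHom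
    (AdjoinSimple.gen ℚ (x : E))
  have hx' : (IntermediateField.inclusion hle).toRingHom (AdjoinSimple.gen ℚ (x : E)) = x := rfl
  rw [hx'] at h
  have hpos : (Module.finrank ℚ ℚ⟮(x : E)⟯ : ℝ) ≠ 0 := by
    exact_mod_cast Module.finrank_pos.ne'
  rw [absMulHeight₁, dif_pos hx]
  have h0 := mulHeight₁_nonneg (AdjoinSimple.gen ℚ (x : E))
  rw [← Real.rpow_natCast, ← Real.rpow_mul h0, mul_comm, Real.rpow_mul h0, Real.rpow_natCast, ← h,
    ← Real.rpow_natCast, ← Real.rpow_mul (mulHeight₁_nonneg _), mul_inv_cancel₀ hpos,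
    Real.rpow_one]

end NumberField

/-! ### A lower bound from the product formula -/

namespace NumberField

open Height

section ProductFormula

variable {L : Type*} [Field L] [NumberField L]

lemma FinitePlace.hasFiniteMulSupport_max_one (x : L) :
    (fun w : FinitePlace L ↦ max (w x) 1).HasFiniteMulSupport := by
  rcases eq_or_ne x 0 with rfl | hx
  · simp [Function.HasFiniteMulSupport]
  · have := FinitePlace.hasFiniteMulSupport hx
    fun_prop

lemma finprod_finitePlace_natCast {p : ℕ} (hp : p ≠ 0) :
    (p : ℝ) ^ Module.finrank ℚ L * ∏ᶠ w : FinitePlace L, w (p : L) = 1 := by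
  have hp' : (p : L) ≠ 0 := mod_cast hp
  have h : Algebra.norm ℚ (p : L) = (p : ℚ) ^ Module.finrank ℚ L := by
    simpa using Algebra.norm_algebraMap (S := L) (p : ℚ)
  rw [FinitePlace.prod_eq_inv_abs_norm hp', h]
  have : (p : ℝ) ≠ 0 := mod_cast hp
  push_cast
  rw [abs_of_nonneg (by positivity), mul_inv_cancel₀ (by positivity)]

lemma FinitePlace.apply_sub_le (w : FinitePlace L) (x y : L) :
    w (x - y) ≤ max (w x) 1 * max (w y) 1 := by
  have h : w (x - y) ≤ max (w x) (w y) := by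
    simpa [sub_eq_add_neg, map_neg_eq_map] using FinitePlace.add_le w x (-y)
  refine h.trans (max_le ?_ ?_)
  · exact (le_max_left _ _).trans (le_mul_of_one_le_right (by positivity) (le_max_right _ _))
  · exact (le_max_left _ _).trans (le_mul_of_one_le_left (by positivity) (le_max_right _ _))

omit [NumberField L] in
lemma InfinitePlace.apply_sub_le (v : InfinitePlace L) (x y : L) :
    v (x - y) ≤ 2 * (max (v x) 1 * max (v y) 1) := by
  have h : v (x - y) ≤ v x + v y := by
    simpa [InfinitePlace.coe_apply] using v.1.sub_le_add x y
  have h1 : v x ≤ max (v x) 1 * max (v y) 1 :=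
    (le_max_left _ _).trans (le_mul_of_one_le_right (by positivity) (le_max_right _ _))
  have h2 : v y ≤ max (v x) 1 * max (v y) 1 :=
    (le_max_left _ _).trans (le_mul_of_one_le_left (by positivity) (le_max_right _ _))
  linarith

/-- If at every finite place one of the differences `x i - y i` is smaller than the trivial bound
by a `k`-th root of `|p|`, then the heights of the `x i`, `y i` cannot all be small. -/
lemma pow_finrank_le_prod_mulHeight₁ {ι : Type*} (s : Finset ι) (x y : ι → L)
    (hne : ∀ i ∈ s, x i ≠ y i) {p : ℕ} (hp : p ≠ 0) (k : ℕ)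
    (h : ∀ w : FinitePlace L, ∃ i ∈ s,
      w (x i - y i) ^ k ≤ w (p : L) * (max (w (x i)) 1 * max (w (y i)) 1) ^ k) :
    (p : ℝ) ^ Module.finrank ℚ L ≤
      (∏ i ∈ s, 2 ^ Module.finrank ℚ L * (mulHeight₁ (x i) * mulHeight₁ (y i))) ^ k := by
  classical
  set n := Module.finrank ℚ L
  -- The index with the gain `|p|` depends on the place, so the product formula is applied to all
  -- differences at once. The other factors get the trivial bound, which at infinite places costs
  -- the factor 2.
  set D : L := ∏ i ∈ s, (x i - y i) with hD
  have hD0 : D ≠ 0 := Finset.prod_ne_zero_iff.mpr fun i hi ↦ sub_ne_zero.mpr (hne i hi)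
  have hp' : (p : L) ≠ 0 := mod_cast hp
  have hpf := prod_abs_eq_one hD0
  set A : ℝ := ∏ v : InfinitePlace L, v D ^ v.mult
  set B : ℝ := ∏ᶠ w : FinitePlace L, w D
  have hB0 : 0 ≤ B := finprod_nonneg fun w ↦ apply_nonneg w D
  have hA0 : 0 ≤ A := Finset.prod_nonneg fun v _ ↦ pow_nonneg (apply_nonneg v D) _
  let mI (i : ι) : ℝ := ∏ v : InfinitePlace L, (max (v (x i)) 1 * max (v (y i)) 1) ^ v.mult
  let mF (i : ι) : ℝ := ∏ᶠ w : FinitePlace L, (max (w (x i)) 1 * max (w (y i)) 1)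
  have hfs (i : ι) : (fun w : FinitePlace L ↦
      max (w (x i)) 1 * max (w (y i)) 1).HasFiniteMulSupport :=
    (FinitePlace.hasFiniteMulSupport_max_one _).mul (FinitePlace.hasFiniteMulSupport_max_one _)
  have hfsp : (fun w : FinitePlace L ↦
      ∏ i ∈ s, (max (w (x i)) 1 * max (w (y i)) 1)).HasFiniteMulSupport :=
    Function.HasFiniteMulSupport.prod hfs s
  have hH (i : ι) : mulHeight₁ (x i) * mulHeight₁ (y i) = mI i * mF i := by
    simp only [mI, mF]
    rw [mulHeight₁_eq, mulHeight₁_eq, finprod_mul_distrib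
      (FinitePlace.hasFiniteMulSupport_max_one _) (FinitePlace.hasFiniteMulSupport_max_one _)]
    simp_rw [mul_pow, Finset.prod_mul_distrib]
    ring
  have hmF0 (i : ι) : 0 ≤ mF i := finprod_nonneg fun w ↦ by positivity
  have hA : A ≤ ∏ i ∈ s, (2 ^ n * mI i) := by
    have h1 : ∏ i ∈ s, (2 ^ n * mI i) = ∏ v : InfinitePlace L,
        (∏ i ∈ s, 2 * (max (v (x i)) 1 * max (v (y i)) 1)) ^ v.mult := by
      simp_rw [← Finset.prod_pow]
      rw [Finset.prod_comm]
      refine Finset.prod_congr rfl fun i _ ↦ ?_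
      simp_rw [mul_pow (2 : ℝ), Finset.prod_mul_distrib, Finset.prod_pow_eq_pow_sum,
        InfinitePlace.sum_mult_eq]
      rfl
    rw [h1]
    refine Finset.prod_le_prod (fun v _ ↦ pow_nonneg (apply_nonneg v D) _) fun v _ ↦ ?_
    refine pow_le_pow_left₀ (apply_nonneg v D) ?_ _
    rw [hD, map_prod]
    exact Finset.prod_le_prod (fun i _ ↦ apply_nonneg v _) fun i _ ↦ v.apply_sub_le _ _
  have hB : (p : ℝ) ^ n * B ^ k ≤ (∏ i ∈ s, mF i) ^ k := by
    have h1 : (∏ i ∈ s, mF i) ^ k =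
        ∏ᶠ w : FinitePlace L, (∏ i ∈ s, (max (w (x i)) 1 * max (w (y i)) 1)) ^ k := by
      rw [← finprod_pow (hfsp), finprod_prod_comm _ _ fun i _ ↦ hfs i]
    have hBk : B ^ k ≤ (∏ᶠ w : FinitePlace L, w (p : L)) * (∏ i ∈ s, mF i) ^ k := by
      have hf1 := FinitePlace.hasFiniteMulSupport hD0
      have hf2 := FinitePlace.hasFiniteMulSupport hp'
      have hf3 : (fun w : FinitePlace L ↦
          (∏ i ∈ s, (max (w (x i)) 1 * max (w (y i)) 1)) ^ k).HasFiniteMulSupport :=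
        hfsp.pow k
      rw [h1, show B ^ k = _ from finprod_pow hf1 k, ← finprod_mul_distrib hf2 hf3]
      refine finprod_le_finprod (hf1.pow k) (fun w ↦ pow_nonneg (apply_nonneg w D) _)
        (hf2.mul hf3) fun w ↦ ?_
      obtain ⟨j, hj, hjw⟩ := h w
      have hwD : w D = ∏ i ∈ s, w (x i - y i) := map_prod w _ s
      beta_reduce
      rw [hwD]
      rw [← Finset.mul_prod_erase s _ hj, ← Finset.mul_prod_erase s _ hj, mul_pow, mul_pow,
        ← mul_assoc]
      refine mul_le_mul hjw (pow_le_pow_left₀ (Finset.prod_nonneg fun i _ ↦ apply_nonneg w _)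
        (Finset.prod_le_prod (fun i _ ↦ apply_nonneg w _) fun i _ ↦ w.apply_sub_le _ _) _)
        (pow_nonneg (Finset.prod_nonneg fun i _ ↦ apply_nonneg w _) _)
        (mul_nonneg (apply_nonneg w _) (by positivity))
    calc (p : ℝ) ^ n * B ^ k
        ≤ (p : ℝ) ^ n * ((∏ᶠ w : FinitePlace L, w (p : L)) * (∏ i ∈ s, mF i) ^ k) := by gcongr
      _ = _ := by rw [← mul_assoc, finprod_finitePlace_natCast hp, one_mul]
  calc (p : ℝ) ^ n = A ^ k * (p ^ n * B ^ k) := by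
        rw [mul_left_comm, ← mul_pow, hpf, one_pow, mul_one]
    _ ≤ (∏ i ∈ s, (2 ^ n * mI i)) ^ k * (∏ i ∈ s, mF i) ^ k := by
        gcongr
    _ = _ := by
        rw [← mul_pow, ← Finset.prod_mul_distrib]
        congr 1
        refine Finset.prod_congr rfl fun i _ ↦ ?_
        rw [hH, mul_assoc]

end ProductFormula

/-! ### Inertia moves elements little -/

section Inertia

variable {L : Type*} [Field L] [NumberField L]

/-- At the prime of `w`, `z` has valuation at least 1 and `p` at most `k`. -/
lemma FinitePlace.apply_pow_le_of_mem (w : FinitePlace L) {z : 𝓞 L}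
    (hz : z ∈ w.maximalIdeal.asIdeal) {p k : ℕ} (hp : p ≠ 0)
    (hk : (p : 𝓞 L) ∉ w.maximalIdeal.asIdeal ^ (k + 1)) : w z ^ k ≤ w (p : L) := by
  set P := w.maximalIdeal.asIdeal
  have hN : (1 : ℝ) ≤ P.absNorm := by
    exact_mod_cast (HeightOneSpectrum.one_lt_absNorm w.maximalIdeal).le
  have hN0 : (0 : ℝ) < P.absNorm := by linarith
  have hpz : (p : 𝓞 L) ≠ 0 := mod_cast hp
  have hwp := w.apply_mul_absNorm_pow_eq_one hpz
  have hm : multiplicity P (Ideal.span {(p : 𝓞 L)}) ≤ k := by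
    by_contra! hlt
    refine hk (Ideal.dvd_span_singleton.mp ?_)
    exact (pow_dvd_pow _ hlt).trans (pow_multiplicity_dvd _ _)
  have hw1 : w z ≤ (P.absNorm : ℝ)⁻¹ := by
    rcases eq_or_ne z 0 with rfl | hz0
    · simp
    have h1 := w.apply_mul_absNorm_pow_eq_one hz0
    have hs : Ideal.span {z} ≠ ⊥ := by simpa using hz0
    have hm1 : 1 ≤ multiplicity P (Ideal.span {z}) := by
      have hfin : FiniteMultiplicity P (Ideal.span {z}) :=
        FiniteMultiplicity.of_prime_left (Ideal.prime_of_isPrime w.maximalIdeal.ne_bot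
          w.maximalIdeal.isPrime) hs
      refine hfin.le_multiplicity_of_pow_dvd ?_
      rw [pow_one]
      exact Ideal.dvd_span_singleton.mpr hz
    rw [← one_div, le_div_iff₀ hN0]
    refine le_trans ?_ h1.le
    gcongr
    exact le_self_pow₀ hN (Nat.one_le_iff_ne_zero.mp hm1)
  calc w z ^ k ≤ ((P.absNorm : ℝ)⁻¹) ^ k := by gcongr
    _ = ((P.absNorm : ℝ) ^ k)⁻¹ := inv_pow _ _
    _ ≤ ((P.absNorm : ℝ) ^ multiplicity P (Ideal.span {(p : 𝓞 L)}))⁻¹ := by gcongr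
    _ = w (p : L) := by
      rw [inv_eq_of_mul_eq_one_left hwp]
      rfl

/-- Elements of the inertia group move an algebraic number only slightly at the given place. -/
lemma FinitePlace.apply_sub_inertia_pow_le (w : FinitePlace L) {g : L ≃ₐ[ℚ] L}
    (hg : g ∈ w.maximalIdeal.asIdeal.inertia (L ≃ₐ[ℚ] L)) (x : L) {p k : ℕ} (hp : p ≠ 0)
    (hk : (p : 𝓞 L) ∉ w.maximalIdeal.asIdeal ^ (k + 1)) :
    w (x - g x) ^ k ≤ w (p : L) * (max (w x) 1 * max (w (g x)) 1) ^ k := by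
  have hsm (a : 𝓞 L) : ((g • a : 𝓞 L) : L) = g a := rfl
  have hgP (a : 𝓞 L) : g • a - a ∈ w.maximalIdeal.asIdeal := hg a
  have hone (d : 𝓞 L) (hd : d ∉ w.maximalIdeal.asIdeal) : w d = 1 := by
    rw [← FinitePlace.norm_embedding_eq]
    exact (FinitePlace.norm_eq_one_iff_notMem L w.maximalIdeal d).mpr hd
  have key (u : L) (n d : 𝓞 L) (hd : d ∉ w.maximalIdeal.asIdeal) (hu : u * d = n) :
      w (u - g u) ^ k ≤ w (p : L) := by
    have hgd : g • d ∉ w.maximalIdeal.asIdeal := fun hmem ↦ hd <| by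
      simpa using Ideal.sub_mem _ hmem (hgP d)
    have hu' : g u * g d = g n := by rw [← map_mul, hu]
    have hz : w (u - g u) = w ((n * (g • d - d) - d * (g • n - n) : 𝓞 L) : L) := by
      have h1 : ((n * (g • d - d) - d * (g • n - n) : 𝓞 L) : L) =
          (u - g u) * ((d : L) * ((g • d : 𝓞 L) : L)) := by
        change (n : L) * (g d - d) - d * (g n - n) = (u - g u) * (d * g d)
        linear_combination (-(g (d : L))) * hu + (d : L) * hu'
      rw [h1, map_mul, map_mul, hone d hd, hone _ hgd]
      simp
    rw [hz]
    exact w.apply_pow_le_of_mem (Ideal.sub_mem _ (Ideal.mul_mem_left _ _ (hgP d))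
      (Ideal.mul_mem_left _ _ (hgP n))) hp hk
  -- Either `x` or `x⁻¹` is integral at `w`. In the second case `x - g x` is, up to sign, `(x⁻¹ - g
  -- x⁻¹) * x * g x`, and the maxima absorb the last two factors.
  obtain ⟨n, d, h | h⟩ :=
    IsDedekindDomain.HeightOneSpectrum.exists_primeCompl_mul_eq_or_mul_eq w.maximalIdeal x
  · refine (key x n d d.2 h).trans (le_mul_of_one_le_right (apply_nonneg w _) ?_)
    exact one_le_pow₀ (one_le_mul_of_one_le_of_one_le (le_max_right _ _) (le_max_right _ _))
  · have hx : x ≠ 0 := by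
      rintro rfl
      have h0 : (d : 𝓞 L) = 0 := by simpa using h.symm
      exact d.2 (h0 ▸ Ideal.zero_mem _)
    have hgx : g x ≠ 0 := by simpa using hx
    have hinv : x⁻¹ * (d : 𝓞 L) = n := by
      rw [show ((d : 𝓞 L) : L) = x * n from h.symm, inv_mul_cancel_left₀ hx]
    have h1 : x - g x = (g x⁻¹ - x⁻¹) * (x * g x) := by
      rw [map_inv₀]
      field_simp
    have h2 : w (x - g x) = w (x⁻¹ - g x⁻¹) * (w x * w (g x)) := by
      rw [h1, map_mul, map_mul, ← map_neg_eq_map w (g x⁻¹ - x⁻¹), neg_sub]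
    rw [h2, mul_pow]
    refine mul_le_mul (key _ n d d.2 hinv) ?_ (by positivity) (apply_nonneg w _)
    gcongr <;> exact le_max_left _ _

end Inertia

end NumberField

/-! ### Normal generation in small groups -/

namespace Subgroup

variable {G : Type*} [Group G]

/-- The `H`-conjugates of elements of `I` generate a subgroup containing `H`. -/
def NormallyGenerates (I H : Subgroup G) : Prop :=
  ∀ N : Subgroup G, (∀ h ∈ H, ∀ g ∈ I, h⁻¹ * g * h ∈ N) → H ≤ N

/-- By Lagrange, a nontrivial subgroup of a group of order at most 3 is the whole group. -/
lemma normallyGenerates_of_card_le_three [Finite G] {I H : Subgroup G} (hIH : I ≤ H)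
    (hI : I ≠ ⊥) (hH : Nat.card H ≤ 3) : I.NormallyGenerates H := by
  have hdvd : Nat.card I ∣ Nat.card H := Subgroup.card_dvd_of_le hIH
  have h1 : 1 < Nat.card I := (Subgroup.one_lt_card_iff_ne_bot I).mpr hI
  have hle : Nat.card H ≤ Nat.card I := by
    obtain ⟨c, hc⟩ := hdvd
    rcases c with _ | _ | c
    · simp [Nat.card_pos.ne'] at hc
    · omega
    · nlinarith
  obtain rfl := Subgroup.eq_of_le_of_card_ge hIH hle
  intro N hN g hg
  simpa using hN 1 (one_mem _) g hg

/-- In `S₃` an even `b` equals `a * (b * a * b⁻¹)` for any transposition `a`, so conjugates of `σ`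
produce all even elements of `H`; multiplying by `σ` reaches the odd ones. -/
lemma normallyGenerates_of_odd {I H : Subgroup G} (φ : G →* Equiv.Perm (Fin 3))
    (hφ : Set.InjOn φ H) (hIH : I ≤ H) {σ : G} (hσ : σ ∈ I) (hodd : (φ σ).sign = -1) :
    I.NormallyGenerates H := by
  have hS3 : ∀ a b : Equiv.Perm (Fin 3), a.sign = -1 → b.sign = 1 → b = a * (b * a * b⁻¹) := by
    decide
  intro N hN
  have hσN : σ ∈ N := by simpa using hN 1 (one_mem _) σ hσ
  have heven (h : G) (hh : h ∈ H) (hs : (φ h).sign = 1) : h ∈ N := by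
    have hmem : h * σ * h⁻¹ ∈ N := by simpa using hN h⁻¹ (inv_mem hh) σ hσ
    have heq : h = σ * (h * σ * h⁻¹) := by
      refine hφ hh ?_ ?_
      · have := hIH hσ
        exact mul_mem this (mul_mem (mul_mem hh this) (inv_mem hh))
      · simpa using hS3 _ _ hodd hs
    rw [heq]
    exact mul_mem hσN hmem
  intro h hh
  rcases Int.units_eq_one_or (φ h).sign with hs | hs
  · exact heven h hh hs
  · have := heven (σ * h) (mul_mem (hIH hσ) hh) (by simp [hodd, hs])
    exact (Subgroup.mul_mem_cancel_left N hσN).mp this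

end Subgroup

/-! ### The height bound from normally generating inertia -/

namespace NumberField

open Height

/-- A height bound for elements not fixed by a small group `H` of automorphisms which is normally
generated by each inertia group above `p`. -/
lemma pow_finrank_le_of_inertia_normallyGenerates {L : Type*} [Field L] [NumberField L]
    {H : Subgroup (L ≃ₐ[ℚ] L)} (hH : Nat.card H ≤ 6) {p : ℕ} (hp : p ≠ 0)
    (hI : ∀ P : Ideal (𝓞 L), P.IsPrime → (p : 𝓞 L) ∈ P →
      P.inertia (L ≃ₐ[ℚ] L) ≤ H ∧ (P.inertia (L ≃ₐ[ℚ] L)).NormallyGenerates H ∧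
        (p : 𝓞 L) ∉ P ^ 7)
    {α : L} (hα : ∃ h ∈ H, h α ≠ α) :
    (p : ℝ) ^ Module.finrank ℚ L ≤
      (2 ^ Module.finrank ℚ L * mulHeight₁ α ^ 2) ^ 216 := by
  classical
  -- At most `6 * 6 = 36` pairs, each raised to the power 6 that bounds the ramification index:
  -- hence the exponent 216.
  let s : Finset (H × H) := {i | i.1.1 α ≠ i.2.1 α}
  have key := pow_finrank_le_prod_mulHeight₁ s (fun i ↦ i.1.1 α) (fun i ↦ i.2.1 α)
    (fun i hi ↦ (Finset.mem_filter.mp hi).2) hp 6 fun w ↦ ?_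
  · simp only [mulHeight₁_algEquiv, Finset.prod_const] at key
    have hcard : s.card ≤ 36 := by
      refine (Finset.card_filter_le _ _).trans ?_
      rw [Finset.card_univ, Fintype.card_prod, ← Nat.card_eq_fintype_card]
      nlinarith
    have h1 : 1 ≤ 2 ^ Module.finrank ℚ L * mulHeight₁ α ^ 2 :=
      one_le_mul_of_one_le_of_one_le (one_le_pow₀ one_le_two)
        (one_le_pow₀ (one_le_mulHeight₁ α))
    rw [← sq, ← pow_mul] at key
    exact key.trans (pow_le_pow_right₀ h1 (by omega))
  · by_cases hw : (p : 𝓞 L) ∈ w.maximalIdeal.asIdeal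
    · obtain ⟨hle, hgen, hp7⟩ := hI _ w.maximalIdeal.isPrime hw
      obtain ⟨h, hh, g, hg, hne⟩ : ∃ h ∈ H, ∃ g ∈ w.maximalIdeal.asIdeal.inertia (L ≃ₐ[ℚ] L),
          h α ≠ g (h α) := by
        by_contra! hcon
        obtain ⟨h, hh, hne⟩ := hα
        -- If inertia fixed every `h α`, the stabilizer of `α` would contain all `h⁻¹ * g * h`,
        -- hence all of `H`.
        refine hne (hgen (MulAction.stabilizer (L ≃ₐ[ℚ] L) α) (fun h hh g hg ↦ ?_) hh)
        change h.symm (g (h α)) = α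
        rw [← hcon h hh g hg, AlgEquiv.symm_apply_apply]
      refine ⟨(⟨h, hh⟩, ⟨g * h, mul_mem (hle hg) hh⟩), ?_,
        w.apply_sub_inertia_pow_le hg (h α) hp hp7⟩
      simpa [s] using hne
    · have hwp : w (p : L) = 1 := by
        rw [← FinitePlace.norm_embedding_eq]
        exact (FinitePlace.norm_eq_one_iff_notMem L w.maximalIdeal (p : 𝓞 L)).mpr hw
      obtain ⟨h, hh, hne⟩ := hα
      refine ⟨(⟨h, hh⟩, 1), by simpa [s] using hne, ?_⟩
      rw [hwp, one_mul]
      exact pow_le_pow_left₀ (apply_nonneg w _) (w.apply_sub_le _ _) 6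

end NumberField

/-! ### Inertia, ramification and discriminants -/

namespace NumberField

section Galois

variable {L : Type*} [Field L] [NumberField L] {p : ℕ} {P : Ideal (𝓞 L)}

omit [NumberField L] in
lemma liesOver_span_natCast_of_mem (hp : p.Prime) (hP : P.IsPrime) (hpP : (p : 𝓞 L) ∈ P) :
    P.LiesOver (Ideal.span {(p : ℤ)}) :=
  (Ideal.liesOver_span_iff hP.ne_top (Nat.prime_iff_prime_int.mp hp)).mpr (by simpa using hpP)

omit [NumberField L] in
lemma intCast_mem_iff_dvd (hp : p.Prime) (hP : P.IsPrime) (hpP : (p : 𝓞 L) ∈ P) (m : ℤ) :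
    (m : 𝓞 L) ∈ P ↔ (p : ℤ) ∣ m := by
  have := liesOver_span_natCast_of_mem hp hP hpP
  rw [← Ideal.mem_span_singleton, Ideal.mem_of_liesOver P (Ideal.span {(p : ℤ)})]
  simp

variable [IsGalois ℚ L]

lemma card_inertia_eq_ramificationIdx (hp : p.Prime) (hP : P.IsPrime) (hpP : (p : 𝓞 L) ∈ P) :
    Nat.card (P.inertia (L ≃ₐ[ℚ] L)) = P.ramificationIdx ℤ := by
  have := liesOver_span_natCast_of_mem hp hP hpP
  have hpi := Nat.prime_iff_prime_int.mp hp
  have hpr : (Ideal.span {(p : ℤ)}).IsPrime := (Ideal.span_singleton_prime hpi.ne_zero).mpr hpi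
  have : (Ideal.span {(p : ℤ)}).IsMaximal :=
    hpr.isMaximal (by simpa using hp.ne_zero)
  have : Finite (ℤ ⧸ Ideal.span {(p : ℤ)}) :=
    Ring.HasFiniteQuotients.finiteQuotient (by simpa using hp.ne_zero)
  rw [Ideal.card_inertia_eq_ramificationIdxIn (G := L ≃ₐ[ℚ] L) (Ideal.span {(p : ℤ)}) P,
    Ideal.ramificationIdxIn_eq_ramificationIdx _ P (L ≃ₐ[ℚ] L)]

lemma card_inertia_eq_multiplicity (hp : p.Prime) (hP : P.IsPrime) (hpP : (p : 𝓞 L) ∈ P) :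
    Nat.card (P.inertia (L ≃ₐ[ℚ] L)) = multiplicity P (Ideal.span {(p : 𝓞 L)}) := by
  have := liesOver_span_natCast_of_mem hp hP hpP
  have hmap : (Ideal.span {(p : ℤ)}).map (algebraMap ℤ (𝓞 L)) = Ideal.span {(p : 𝓞 L)} := by
    simp [Ideal.map_span]
  rw [card_inertia_eq_ramificationIdx hp hP hpP,
    Ideal.IsDedekindDomain.ramificationIdx_eq_multiplicity (Ideal.span {(p : ℤ)}) P, hmap]
  rw [hmap]
  simpa using hp.ne_zero

omit [IsGalois ℚ L] in
lemma finiteMultiplicity_span_singleton (hp : p.Prime) (hP : P.IsPrime) (hpP : (p : 𝓞 L) ∈ P)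
    {x : 𝓞 L} (hx : x ≠ 0) : FiniteMultiplicity P (Ideal.span {x}) := by
  have hP0 : P ≠ ⊥ := by
    rintro rfl
    exact hp.ne_zero (by simpa using hpP)
  exact FiniteMultiplicity.of_prime_left (Ideal.prime_of_isPrime hP0 hP) (by simpa using hx)

lemma natCast_notMem_pow_of_card_inertia_lt (hp : p.Prime) (hP : P.IsPrime)
    (hpP : (p : 𝓞 L) ∈ P) {k : ℕ} (hk : Nat.card (P.inertia (L ≃ₐ[ℚ] L)) < k) :
    (p : 𝓞 L) ∉ P ^ k := by
  intro hmem
  rw [card_inertia_eq_multiplicity hp hP hpP] at hk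
  have hfin := finiteMultiplicity_span_singleton hp hP hpP (x := (p : 𝓞 L))
    (by exact_mod_cast hp.ne_zero)
  exact hk.not_ge (hfin.le_multiplicity_of_pow_dvd (Ideal.dvd_span_singleton.mpr hmem))

/-- In a Galois extension all primes above `p` have the same ramification index, so trivial inertia
at one of them makes `p` unramified in `L`, although `discr F` divides `discr L`. -/
lemma inertia_ne_bot_of_dvd_discr (hp : p.Prime) (hP : P.IsPrime) (hpP : (p : 𝓞 L) ∈ P)
    (F : Type*) [Field F] [NumberField F] [Algebra F L] (hdvd : (p : ℤ) ∣ discr F) :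
    P.inertia (L ≃ₐ[ℚ] L) ≠ ⊥ := by
  intro hbot
  have hpi := Nat.prime_iff_prime_int.mp hp
  refine absurd (hdvd.trans (discr_dvd_discr F L)) ?_
  rw [not_dvd_discr_iff_forall_mem L (𝓞 L) hpi]
  intro Q hQ hpQ
  have hpQ' : (p : 𝓞 L) ∈ Q := by simpa using hpQ
  have := liesOver_span_natCast_of_mem hp hP hpP
  have := liesOver_span_natCast_of_mem hp hQ hpQ'
  have h1 : Q.ramificationIdx ℤ = 1 := by
    rw [← Ideal.ramificationIdxIn_eq_ramificationIdx (Ideal.span {(p : ℤ)}) Q (L ≃ₐ[ℚ] L),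
      Ideal.ramificationIdxIn_eq_ramificationIdx (Ideal.span {(p : ℤ)}) P (L ≃ₐ[ℚ] L),
      ← card_inertia_eq_ramificationIdx hp hP hpP, hbot, Subgroup.card_bot]
  exact Ideal.ramificationIdx_eq_one_iff.mp h1

/-- If an integer is a square in `𝓞 L` and has odd valuation at `p`,
then the inertia groups above `p` have even order. -/
lemma even_card_inertia_of_sq_eq (hp : p.Prime) (hP : P.IsPrime) (hpP : (p : 𝓞 L) ∈ P)
    {δ : 𝓞 L} {d : ℤ} (hδ : δ ^ 2 = d) (hd : ¬ 2 ∣ padicValInt p d) :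
    2 ∣ Nat.card (P.inertia (L ≃ₐ[ℚ] L)) := by
  have hd0 : d ≠ 0 := by
    rintro rfl
    simp at hd
  have hδ0 : δ ≠ 0 := by
    rintro rfl
    exact hd0 (by simpa using hδ.symm)
  have hP0 : P ≠ ⊥ := by
    rintro rfl
    exact hp.ne_zero (by simpa using hpP)
  have hprime : Prime P := Ideal.prime_of_isPrime hP0 hP
  have : Fact p.Prime := ⟨hp⟩
  obtain ⟨m, hm⟩ := padicValInt_dvd (p := p) d
  have hpm : ¬ (p : ℤ) ∣ m := by
    intro ⟨c, hc⟩
    have h1 : (p : ℤ) ^ (padicValInt p d + 1) ∣ d := ⟨c, by rw [pow_succ, mul_assoc, ← hc, ← hm]⟩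
    rw [padicValInt_dvd_iff] at h1
    rcases h1 with h1 | h1
    · exact hd0 h1
    · omega
  have hm0 : m ≠ 0 := by
    rintro rfl
    simp at hpm
  have e1 : emultiplicity P (Ideal.span {δ} ^ 2) =
      emultiplicity P (Ideal.span {(p : 𝓞 L)} ^ padicValInt p d * Ideal.span {(m : 𝓞 L)}) := by
    rw [Ideal.span_singleton_pow, hδ, Ideal.span_singleton_pow,
      Ideal.span_singleton_mul_span_singleton]
    nth_rewrite 1 [hm]
    push_cast
    rfl
  have e2 : emultiplicity P (Ideal.span {(m : 𝓞 L)}) = 0 := by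
    rw [emultiplicity_eq_zero, Ideal.dvd_span_singleton, intCast_mem_iff_dvd hp hP hpP]
    exact hpm
  rw [emultiplicity_mul hprime, emultiplicity_pow hprime, emultiplicity_pow hprime, e2, add_zero,
    (finiteMultiplicity_span_singleton hp hP hpP hδ0).emultiplicity_eq_multiplicity,
    (finiteMultiplicity_span_singleton hp hP hpP
      (by exact_mod_cast hp.ne_zero)).emultiplicity_eq_multiplicity,
    ← card_inertia_eq_multiplicity hp hP hpP] at e1
  -- Compare valuations at `P` in `δ² = p ^ v * m` with `p ∤ m`; the valuation of `p` is the order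
  -- of inertia.
  have e3 : 2 * multiplicity P (Ideal.span {δ}) =
      padicValInt p d * Nat.card (P.inertia (L ≃ₐ[ℚ] L)) := by exact_mod_cast e1
  exact (Nat.prime_two.dvd_mul.mp (Dvd.intro _ e3)).resolve_left hd

end Galois

/-- Inertia above a prime not dividing `discr F` acts trivially on all conjugates of `F`. -/
lemma inertia_apply_eq_self_of_not_dvd_discr {E : Type*} [Field E] [CharZero E] [IsAlgClosed E]
    (L : IntermediateField ℚ E) [NumberField L] {p : ℕ} (hp : p.Prime) {P : Ideal (𝓞 L)}
    (hP : P.IsPrime) (hpP : (p : 𝓞 L) ∈ P) (F : Type*) [Field F] [NumberField F]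
    (hF : ∀ f : F →ₐ[ℚ] E, f.fieldRange ≤ L) (hdvd : ¬ (p : ℤ) ∣ discr F)
    {g : L ≃ₐ[ℚ] L} (hg : g ∈ P.inertia (L ≃ₐ[ℚ] L)) (f : F →ₐ[ℚ] L) (x : F) :
    g (f x) = f x := by
  classical
  by_contra hne
  let f₁ : F →ₐ[ℚ] E := L.val.comp f
  let f₂ : F →ₐ[ℚ] E := L.val.comp ((g : L →ₐ[ℚ] L).comp f)
  have hf : f₁ ≠ f₂ := fun h ↦ hne (Subtype.ext (DFunLike.congr_fun h x).symm)
  let ι := Module.Free.ChooseBasisIndex ℤ (𝓞 F)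
  have hcard : Fintype.card ι = Fintype.card (F →ₐ[ℚ] E) := by
    rw [AlgHom.card, ← Module.finrank_eq_card_basis (integralBasis F)]
  let e : ι ≃ (F →ₐ[ℚ] E) := Fintype.equivOfCardEq hcard
  have hint (f : F →ₐ[ℚ] E) (i : ι) :
      IsIntegral ℤ (⟨f (integralBasis F i), hF f ⟨_, rfl⟩⟩ : L) := by
    have h1 : IsIntegral ℤ (integralBasis F i) := by
      rw [integralBasis_apply]
      exact RingOfIntegers.isIntegral_coe _
    refine (isIntegral_algHom_iff (L.val.restrictScalars ℤ) Subtype.val_injective).mp ?_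
    exact h1.map (f.restrictScalars ℤ)
  -- The conjugates of an integral basis, with `det² = discr F`. If `g` moved `f`, the distinct
  -- columns of `f` and `g ∘ f` would agree modulo `P`, forcing `p ∣ discr F`.
  let N : Matrix ι ι (𝓞 L) := .of fun i j ↦ ⟨_, hint (e j) i⟩
  let ψ : 𝓞 L →+* E := (algebraMap L E).comp (algebraMap (𝓞 L) L)
  have hψ : Function.Injective ψ := (algebraMap L E).injective.comp RingOfIntegers.coe_injective
  have hdet : N.det ^ 2 = (discr F : 𝓞 L) := by
    apply hψ
    have h1 := Algebra.discr_eq_det_embeddingsMatrixReindex_pow_two ℚ E (integralBasis F) e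
    have h2 : Algebra.embeddingsMatrixReindex ℚ E (integralBasis F) e = N.map ψ := by
      ext i j
      rfl
    rw [← coe_discr, h2] at h1
    rw [map_pow, RingHom.map_det, RingHom.mapMatrix_apply, ← h1]
    simp
  have hmem : N.det ∈ P := by
    rw [← Ideal.Quotient.eq_zero_iff_mem, RingHom.map_det]
    refine Matrix.det_zero_of_column_eq (i := e.symm f₁) (j := e.symm f₂)
      (by simpa using hf) fun k ↦ ?_
    rw [RingHom.mapMatrix_apply, Matrix.map_apply, Matrix.map_apply, eq_comm,
      Ideal.Quotient.mk_eq_mk_iff_sub_mem]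
    have hk : N k (e.symm f₂) = g • N k (e.symm f₁) := by
      apply RingOfIntegers.coe_injective
      apply Subtype.ext
      change (e (e.symm f₂)) (integralBasis F k) = (g ⟨(e (e.symm f₁)) (integralBasis F k), _⟩ : L)
      simp only [Equiv.apply_symm_apply]
      rfl
    rw [hk]
    exact hg _
  refine hdvd ((intCast_mem_iff_dvd hp hP hpP _).mp ?_)
  rw [← hdet, sq]
  exact Ideal.mul_mem_left _ _ hmem

end NumberField

/-! ### Galois action on the roots of a cubic -/

section CubicRoots

variable {L : Type*} [Field L]

/-- The automorphisms permute a family `r` of elements. -/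
lemma exists_permHom_of_forall_exists_apply_eq {k ι : Type*} [Field k] [Algebra k L] {r : ι → L}
    (hr : Function.Injective r) (hmem : ∀ (g : L ≃ₐ[k] L) (i : ι), ∃ j, g (r i) = r j) :
    ∃ φ : (L ≃ₐ[k] L) →* Equiv.Perm ι, ∀ g i, g (r i) = r (φ g i) := by
  choose σ hσ using hmem
  let ψ : (L ≃ₐ[k] L) →* Function.End ι :=
    { toFun := σ
      map_one' := funext fun i ↦ hr (hσ 1 i).symm
      map_mul' := fun g h ↦ funext fun i ↦ hr <| by
        rw [← hσ]
        change g (h (r i)) = r (σ g (σ h i))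
        rw [hσ h, hσ g] }
  exact ⟨ψ.toHomPerm, fun g i ↦ hσ g i⟩

variable [CharZero L]

/-- A monic integral cubic polynomial with a root of degree three in a normal extension has three
distinct roots there. -/
lemma exists_roots_of_natDegree_eq_three [Normal ℚ L] {f : ℤ[X]} (hf : f.Monic)
    (hdeg : f.natDegree = 3) {y : L} (hy : aeval y f = 0) (hmin : (minpoly ℚ y).natDegree = 3) :
    ∃ r : Fin 3 → L, Function.Injective r ∧
      f.map (Int.castRingHom L) = (X - C (r 0)) * (X - C (r 1)) * (X - C (r 2)) := by
  have hyint : IsIntegral ℚ y := Normal.isIntegral inferInstance y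
  have hq : minpoly ℚ y = f.map (Int.castRingHom ℚ) := by
    refine (eq_of_monic_of_dvd_of_natDegree_le (minpoly.monic hyint) (hf.map _)
      (minpoly.dvd ℚ y ?_) ?_).symm
    · rw [aeval_def, eval₂_map, ← hy, aeval_def]
      congr 1
      exact RingHom.ext_int _ _
    · rw [hmin, (hf.natDegree_map _), hdeg]
  have hmap : (minpoly ℚ y).map (algebraMap ℚ L) = f.map (Int.castRingHom L) := by
    rw [hq, Polynomial.map_map]
    congr 1
    exact RingHom.ext_int _ _
  have hsplit : (f.map (Int.castRingHom L)).Splits := hmap ▸ Normal.splits inferInstance y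
  have hnodup : (f.map (Int.castRingHom L)).roots.Nodup := by
    rw [← hmap]
    exact nodup_roots ((minpoly.irreducible hyint).separable.map)
  have hcard : (f.map (Int.castRingHom L)).roots.card = 3 := by
    rw [← hsplit.natDegree_eq_card_roots, hf.natDegree_map, hdeg]
  obtain ⟨a, b, c, habc⟩ := Multiset.card_eq_three.mp hcard
  refine ⟨![a, b, c], ?_, ?_⟩
  · rw [habc] at hnodup
    have h : a ≠ b ∧ a ≠ c ∧ b ≠ c := by simp at hnodup; tauto
    intro i j hij
    fin_cases i <;> fin_cases j <;> simp_all
  · have := hsplit.eq_prod_roots_of_monic (hf.map _)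
    rw [habc] at this
    simpa [mul_assoc] using this

variable {f : ℤ[X]} {r : Fin 3 → L}

omit [CharZero L] in
lemma intCast_coeff_of_map_eq
    (h : f.map (Int.castRingHom L) = (X - C (r 0)) * (X - C (r 1)) * (X - C (r 2))) :
    (f.coeff 0 : L) = -(r 0 * r 1 * r 2) ∧ (f.coeff 1 : L) = r 0 * r 1 + r 0 * r 2 + r 1 * r 2 ∧
      (f.coeff 2 : L) = -(r 0 + r 1 + r 2) ∧ (f.coeff 3 : L) = 1 := by
  have h' : f.map (Int.castRingHom L) = X ^ 3 + C (-(r 0 + r 1 + r 2)) * X ^ 2 +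
      C (r 0 * r 1 + r 0 * r 2 + r 1 * r 2) * X + C (-(r 0 * r 1 * r 2)) := by
    rw [h]
    simp only [map_add, map_neg, map_mul]
    ring
  have hc (n : ℕ) : (f.coeff n : L) = (f.map (Int.castRingHom L)).coeff n := by simp
  simp only [hc, h']
  generalize -(r 0 + r 1 + r 2) = a
  generalize r 0 * r 1 + r 0 * r 2 + r 1 * r 2 = b
  refine ⟨?_, ?_, ?_, ?_⟩ <;> simp [coeff_X, coeff_C]

omit [CharZero L] in
lemma intCast_discr_of_map_eq (hdeg : f.degree = 3)
    (h : f.map (Int.castRingHom L) = (X - C (r 0)) * (X - C (r 1)) * (X - C (r 2))) :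
    (f.discr : L) = ((r 0 - r 1) * (r 0 - r 2) * (r 1 - r 2)) ^ 2 := by
  obtain ⟨h0, h1, h2, h3⟩ := intCast_coeff_of_map_eq h
  rw [discr_of_degree_eq_three hdeg]
  push_cast
  rw [h0, h1, h2, h3]
  ring

omit [CharZero L] in
lemma exists_apply_eq_of_map_eq [Algebra ℚ L]
    (h : f.map (Int.castRingHom L) = (X - C (r 0)) * (X - C (r 1)) * (X - C (r 2)))
    (g : L ≃ₐ[ℚ] L) (i : Fin 3) : ∃ j, g (r i) = r j := by
  have hroot : (f.map (Int.castRingHom L)).eval (r i) = 0 := by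
    rw [h]
    fin_cases i <;> simp
  have hroot' : (f.map (Int.castRingHom L)).eval (g (r i)) = 0 := by
    rw [eval_map] at hroot ⊢
    have := hom_eval₂ f (Int.castRingHom L) (g : L →+* L) (r i)
    rw [hroot, map_zero] at this
    rw [show Int.castRingHom L = (g : L →+* L).comp (Int.castRingHom L) from RingHom.ext_int _ _]
    exact this.symm
  rw [h] at hroot'
  simp only [eval_mul, eval_sub, eval_X, eval_C, mul_eq_zero, sub_eq_zero] at hroot'
  rcases hroot' with (h | h) | h
  exacts [⟨0, h⟩, ⟨1, h⟩, ⟨2, h⟩]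

end CubicRoots

namespace NumberField

/-! ### Transpositions in inertia -/

section CubicInertia

variable {L : Type*} [Field L] [NumberField L] [IsGalois ℚ L] {p : ℕ} {P : Ideal (𝓞 L)}
  {f : ℤ[X]} {r : Fin 3 → L} {φ : (L ≃ₐ[ℚ] L) →* Equiv.Perm (Fin 3)}
  {H : Subgroup (L ≃ₐ[ℚ] L)}

omit [NumberField L] [IsGalois ℚ L] in
lemma isIntegral_of_map_eq [CharZero L] (hf : f.Monic)
    (h : f.map (Int.castRingHom L) = (X - C (r 0)) * (X - C (r 1)) * (X - C (r 2))) (i : Fin 3) :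
    IsIntegral ℤ (r i) := by
  refine ⟨f, hf, ?_⟩
  rw [show algebraMap ℤ L = Int.castRingHom L from RingHom.ext_int _ _, ← eval_map, h]
  fin_cases i <;> simp

/-- The discriminant is a square in `𝓞 L`, so its odd valuation makes the inertia order even. By
Cauchy there is an involution, and a faithful one in `S₃` is a transposition. -/
lemma exists_odd_of_odd_padicValInt_discr (hp : p.Prime) (hP : P.IsPrime) (hpP : (p : 𝓞 L) ∈ P)
    (hf : f.Monic) (hdeg : f.natDegree = 3)
    (h : f.map (Int.castRingHom L) = (X - C (r 0)) * (X - C (r 1)) * (X - C (r 2)))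
    (hφ : Set.InjOn φ H) (hIH : P.inertia (L ≃ₐ[ℚ] L) ≤ H)
    (hodd : ¬ 2 ∣ padicValInt p f.discr) :
    ∃ σ ∈ P.inertia (L ≃ₐ[ℚ] L), (φ σ).sign = -1 := by
  have hdeg' : f.degree = 3 := by
    rw [degree_eq_natDegree hf.ne_zero, hdeg]
    rfl
  let s (i : Fin 3) : 𝓞 L := ⟨r i, isIntegral_of_map_eq hf h i⟩
  have hδ : ((s 0 - s 1) * (s 0 - s 2) * (s 1 - s 2)) ^ 2 = (f.discr : 𝓞 L) := by
    apply RingOfIntegers.coe_injective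
    change ((r 0 - r 1) * (r 0 - r 2) * (r 1 - r 2)) ^ 2 = ((f.discr : 𝓞 L) : L)
    rw [← intCast_discr_of_map_eq hdeg' h]
    simp
  have heven := even_card_inertia_of_sq_eq hp hP hpP hδ hodd
  have : Fact (Nat.Prime 2) := ⟨Nat.prime_two⟩
  obtain ⟨σ, hσ⟩ := exists_prime_orderOf_dvd_card' 2 heven
  have hσ' : orderOf (σ : L ≃ₐ[ℚ] L) = 2 := by rw [Subgroup.orderOf_coe, hσ]
  have h2 : (φ σ) * (φ σ) = 1 := by
    rw [← map_mul, ← sq, ← hσ', pow_orderOf_eq_one, map_one]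
  have h1 : φ σ ≠ 1 := by
    intro h1
    have : (σ : L ≃ₐ[ℚ] L) = 1 := hφ (hIH σ.2) (one_mem H) (by rw [h1, map_one])
    rw [this, orderOf_one] at hσ'
    omega
  have hS3 : ∀ a : Equiv.Perm (Fin 3), a * a = 1 → a ≠ 1 → a.sign = -1 := by decide
  exact ⟨σ, σ.2, hS3 _ h2 h1⟩

omit [IsGalois ℚ L] in
-- Otherwise inertia contains a 3-cycle and all roots are congruent modulo `P`. A vanishing middle
-- coefficient then puts `3 * s 0 ^ 2` or `3 * s 0` in `P`; as `p ≠ 3`, all roots lie in `P` and `p`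
-- divides every lower coefficient.
lemma exists_odd_of_not_dvd_coeff (hp : p.Prime) (hp3 : p ≠ 3) (hP : P.IsPrime)
    (hpP : (p : 𝓞 L) ∈ P) (hf : f.Monic)
    (h : f.map (Int.castRingHom L) = (X - C (r 0)) * (X - C (r 1)) * (X - C (r 2)))
    (hr : ∀ g i, g (r i) = r (φ g i))
    (hφ : Set.InjOn φ H) (hIH : P.inertia (L ≃ₐ[ℚ] L) ≤ H)
    (hI : P.inertia (L ≃ₐ[ℚ] L) ≠ ⊥) (hzero : f.coeff 1 = 0 ∨ f.coeff 2 = 0)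
    (hcop : ¬ ((p : ℤ) ∣ f.coeff 0 ∧ (p : ℤ) ∣ f.coeff 1 ∧ (p : ℤ) ∣ f.coeff 2)) :
    ∃ σ ∈ P.inertia (L ≃ₐ[ℚ] L), (φ σ).sign = -1 := by
  obtain ⟨σ, hσ, hσ1⟩ := (Subgroup.bot_or_exists_ne_one _).resolve_left hI
  refine ⟨σ, hσ, ?_⟩
  by_contra hsign
  have hS3 : ∀ a : Equiv.Perm (Fin 3), a.sign ≠ -1 → a ≠ 1 →
      (a 0 = 1 ∧ a 1 = 2 ∨ a 0 = 2 ∧ a 2 = 1) := by decide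
  have hφ1 : φ σ ≠ 1 := fun h1 ↦ hσ1 (hφ (hIH hσ) (one_mem H) (by rw [h1, map_one]))
  let s (i : Fin 3) : 𝓞 L := ⟨r i, isIntegral_of_map_eq hf h i⟩
  have hcongr (i : Fin 3) : s (φ σ i) - s i ∈ P := by
    have : σ • s i = s (φ σ i) := by
      apply RingOfIntegers.coe_injective
      exact hr σ i
    rw [← this]
    exact hσ (s i)
  obtain ⟨h0, h1, h2, -⟩ := intCast_coeff_of_map_eq h
  have e0 : (f.coeff 0 : 𝓞 L) = -(s 0 * s 1 * s 2) := RingOfIntegers.coe_injective (by simpa [s])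
  have e1 : (f.coeff 1 : 𝓞 L) = s 0 * s 1 + s 0 * s 2 + s 1 * s 2 :=
    RingOfIntegers.coe_injective (by simpa [s])
  have e2 : (f.coeff 2 : 𝓞 L) = -(s 0 + s 1 + s 2) := RingOfIntegers.coe_injective (by simpa [s])
  have hall : s 1 - s 0 ∈ P ∧ s 2 - s 0 ∈ P := by
    rcases hS3 _ hsign hφ1 with ⟨h01, h12⟩ | ⟨h02, h21⟩
    · have c0 := hcongr 0
      have c1 := hcongr 1
      rw [h01] at c0
      rw [h12] at c1
      exact ⟨c0, by simpa using add_mem c1 c0⟩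
    · have c0 := hcongr 0
      have c2 := hcongr 2
      rw [h02] at c0
      rw [h21] at c2
      exact ⟨by simpa using add_mem c2 c0, c0⟩
  have h3 : ((3 : ℤ) : 𝓞 L) ∉ P := by
    rw [intCast_mem_iff_dvd hp hP hpP]
    intro h3
    exact hp3 ((Nat.prime_dvd_prime_iff_eq hp Nat.prime_three).mp (by exact_mod_cast h3))
  have hs0 : s 0 ∈ P := by
    rcases hzero with hz | hz
    · rw [hz] at e1
      have : ((3 : ℤ) : 𝓞 L) * (s 0 * s 0) ∈ P := by
        have : ((3 : ℤ) : 𝓞 L) * (s 0 * s 0) =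
            -((2 * s 0 + (s 2 - s 0)) * (s 1 - s 0) + 2 * s 0 * (s 2 - s 0)) := by
          push_cast at e1 ⊢
          linear_combination -e1
        rw [this]
        exact neg_mem (add_mem (Ideal.mul_mem_left _ _ hall.1) (Ideal.mul_mem_left _ _ hall.2))
      have := (hP.mem_or_mem this).resolve_left h3
      exact (hP.mem_or_mem this).elim id id
    · rw [hz] at e2
      have : ((3 : ℤ) : 𝓞 L) * s 0 ∈ P := by
        have : ((3 : ℤ) : 𝓞 L) * s 0 = -((s 1 - s 0) + (s 2 - s 0)) := by
          push_cast at e2 ⊢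
          linear_combination e2
        rw [this]
        exact neg_mem (add_mem hall.1 hall.2)
      exact (hP.mem_or_mem this).resolve_left h3
  have hs1 : s 1 ∈ P := by simpa using add_mem hall.1 hs0
  have hs2 : s 2 ∈ P := by simpa using add_mem hall.2 hs0
  refine hcop ⟨?_, ?_, ?_⟩ <;> rw [← intCast_mem_iff_dvd hp hP hpP]
  · rw [e0]
    exact neg_mem (Ideal.mul_mem_left _ _ hs2)
  · rw [e1]
    exact add_mem (add_mem (Ideal.mul_mem_left _ _ hs1) (Ideal.mul_mem_left _ _ hs2))
      (Ideal.mul_mem_left _ _ hs2)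
  · rw [e2]
    exact neg_mem (add_mem (add_mem hs0 hs1) hs2)

end CubicInertia

end NumberField

/-! ### Automorphisms of one step of the tower -/

section Tower

variable {E : Type*} [Field E] [CharZero E]

/-- The elements of `L` fixed by an automorphism of `L`, as a subfield of the ambient field. -/
noncomputable def AlgEquiv.fixedFieldLift {L : IntermediateField ℚ E} (g : L ≃ₐ[ℚ] L) :
    IntermediateField ℚ E :=
  IntermediateField.lift (fixedField (Subgroup.zpowers g))

lemma AlgEquiv.coe_mem_fixedFieldLift {L : IntermediateField ℚ E} {g : L ≃ₐ[ℚ] L} {x : L} :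
    (x : E) ∈ g.fixedFieldLift ↔ g x = x := by
  rw [AlgEquiv.fixedFieldLift, IntermediateField.mem_lift, mem_fixedField_iff]
  refine ⟨fun h ↦ h g (Subgroup.mem_zpowers g), fun h f hf ↦ ?_⟩
  have hle : Subgroup.zpowers g ≤ MulAction.stabilizer (L ≃ₐ[ℚ] L) x :=
    Subgroup.zpowers_le.mpr h
  exact hle hf

/-- The automorphisms of `L` that fix the elements of `L` lying in `K`. -/
noncomputable def IntermediateField.relativeFixingSubgroup (K L : IntermediateField ℚ E) :
    Subgroup (L ≃ₐ[ℚ] L) :=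
  (K.comap L.val).fixingSubgroup

variable {K L : IntermediateField ℚ E}

lemma IntermediateField.mem_relativeFixingSubgroup {g : L ≃ₐ[ℚ] L} :
    g ∈ K.relativeFixingSubgroup L ↔ ∀ x : L, (x : E) ∈ K → g x = x :=
  mem_fixingSubgroup_iff _ _

lemma IntermediateField.exists_apply_ne_of_notMem [FiniteDimensional ℚ L] [IsGalois ℚ L] {x : L}
    (hx : (x : E) ∉ K) : ∃ h ∈ K.relativeFixingSubgroup L, h x ≠ x := by
  by_contra! hcon
  refine hx ?_
  change x ∈ K.comap L.val
  have : @IsGalois ℚ _ L _ L.algebra' := ‹IsGalois ℚ L›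
  have : @FiniteDimensional ℚ L _ _ L.algebra'.toModule := ‹FiniteDimensional ℚ L›
  rw [← IsGalois.fixedField_fixingSubgroup (K.comap L.val), mem_fixedField_iff]
  exact hcon

lemma AlgEquiv.le_fixedFieldLift_of_mem_relativeFixingSubgroup (hKL : K ≤ L) {g : L ≃ₐ[ℚ] L}
    (hg : g ∈ K.relativeFixingSubgroup L) : K ≤ g.fixedFieldLift := fun x hx ↦
  (AlgEquiv.coe_mem_fixedFieldLift (x := ⟨x, hKL hx⟩)).mpr (mem_relativeFixingSubgroup.mp hg _ hx)

lemma AlgEquiv.eq_one_of_le_fixedFieldLift {g : L ≃ₐ[ℚ] L} (h : L ≤ g.fixedFieldLift) : g = 1 :=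
  AlgEquiv.ext fun x ↦ AlgEquiv.coe_mem_fixedFieldLift.mp (h x.2)

variable {F : IntermediateField ℚ E}

/-- Since `K` and `F` generate `L`, an automorphism over `K` is determined by its restriction to
`F`, and `F` has at most `[F : ℚ]` embeddings in `L`. -/
lemma IntermediateField.card_relativeFixingSubgroup_le_three [FiniteDimensional ℚ F]
    [FiniteDimensional ℚ L] (hKL : K ≤ L) (hFL : F ≤ L) (hL : L ≤ K ⊔ F)
    (hF : Module.finrank ℚ F ≤ 3) : Nat.card (K.relativeFixingSubgroup L) ≤ 3 := by
  let ρ : K.relativeFixingSubgroup L → (F →ₐ[ℚ] L) :=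
    fun h ↦ ((h : L ≃ₐ[ℚ] L) : L →ₐ[ℚ] L).comp (inclusion hFL)
  have hρ : Function.Injective ρ := by
    intro g h hgh
    have hfix : L ≤ ((g⁻¹ * h : K.relativeFixingSubgroup L) : L ≃ₐ[ℚ] L).fixedFieldLift := by
      refine hL.trans (sup_le
        (AlgEquiv.le_fixedFieldLift_of_mem_relativeFixingSubgroup hKL (g⁻¹ * h).2) fun x hx ↦ ?_)
      refine (AlgEquiv.coe_mem_fixedFieldLift (x := ⟨x, hFL hx⟩)).mpr ?_
      have := DFunLike.congr_fun hgh ⟨x, hx⟩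
      change (g : L ≃ₐ[ℚ] L).symm ((h : L ≃ₐ[ℚ] L) _) = _
      rw [AlgEquiv.symm_apply_eq]
      exact this.symm
    have := AlgEquiv.eq_one_of_le_fixedFieldLift hfix
    exact (inv_mul_eq_one.mp (Subtype.ext this))
  have : Finite (F →ₐ[ℚ] L) := inferInstance
  exact (Nat.card_le_card_of_injective ρ hρ).trans ((card_algHom_le_finrank ℚ F L).trans hF)

lemma IntermediateField.isGalois_of_finrank_le_two [FiniteDimensional ℚ F]
    (hF : Module.finrank ℚ F ≤ 2) : IsGalois ℚ F := by
  have hpos : 0 < Module.finrank ℚ F := Module.finrank_pos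
  interval_cases h : Module.finrank ℚ F
  · obtain rfl := finrank_eq_one_iff.mp h
    exact isGalois_bot
  · have : Algebra.IsQuadraticExtension ℚ F := ⟨h⟩
    infer_instance

variable [IsAlgClosed E] [Algebra.IsAlgebraic ℚ E]

lemma IntermediateField.normalClosure_adjoin_simple (y : E) :
    normalClosure ℚ ℚ⟮y⟯ E = ⨆ σ : E ≃ₐ[ℚ] E, ℚ⟮σ y⟯ := by
  have : Normal ℚ E := normal_iff.mpr fun x ↦
    ⟨Algebra.IsIntegral.isIntegral x, IsAlgClosed.splits _⟩
  refine (normalClosure_def'' (K := ℚ⟮y⟯)).trans ?_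
  refine iSup_congr fun σ ↦ ?_
  rw [adjoin_map, Set.image_singleton]
  rfl

/-- A pure cubic field becomes normal over any field containing the cube roots of unity. -/
lemma IntermediateField.normalClosure_adjoin_le_of_pow_three_eq {z β : E} (hz : z ^ 2 + z + 1 = 0)
    (hzK : z ∈ K) {q : ℚ} (hq : β ^ 3 = algebraMap ℚ E q) :
    normalClosure ℚ ℚ⟮β⟯ E ≤ K ⊔ ℚ⟮β⟯ := by
  rw [normalClosure_adjoin_simple]
  refine iSup_le fun σ ↦ adjoin_simple_le_iff.mpr ?_
  have hβ : β ∈ K ⊔ ℚ⟮β⟯ := (le_sup_right : ℚ⟮β⟯ ≤ K ⊔ ℚ⟮β⟯) (mem_adjoin_simple_self ℚ β)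
  have hz' : z ∈ K ⊔ ℚ⟮β⟯ := (le_sup_left : K ≤ K ⊔ ℚ⟮β⟯) hzK
  have h3 : σ β ^ 3 = β ^ 3 := by rw [← map_pow, hq, AlgEquiv.commutes]
  -- The cube roots of `β³` are `β`, `z β` and `z² β`, where `z² = -1 - z`.
  have hfac : (σ β - β) * ((σ β - z * β) * (σ β - (-1 - z) * β)) = 0 := by
    linear_combination h3 + (-(β ^ 2 * σ β) + β ^ 3) * hz
  rcases mul_eq_zero.mp hfac with h | h
  · rwa [sub_eq_zero.mp h]
  · rcases mul_eq_zero.mp h with h | h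
    · rw [sub_eq_zero.mp h]
      exact mul_mem hz' hβ
    · rw [sub_eq_zero.mp h]
      exact mul_mem (sub_mem (neg_mem (one_mem _)) hz') hβ

/-- If `L` is generated over `K` by the conjugates of a cubic field, then the automorphisms of
`L` over `K` act faithfully on the three conjugates of a generator. -/
lemma IntermediateField.exists_permHom_of_cubic [FiniteDimensional ℚ L] [IsGalois ℚ L]
    (hKL : K ≤ L) (hFL : normalClosure ℚ F E ≤ L) (hL : L ≤ K ⊔ normalClosure ℚ F E) {y : E}
    (hFy : F = ℚ⟮y⟯) (hdeg : Module.finrank ℚ F = 3) {f : ℤ[X]} (hf : f.Monic)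
    (hf3 : f.natDegree = 3) (hy : aeval y f = 0) :
    ∃ (r : Fin 3 → L) (φ : (L ≃ₐ[ℚ] L) →* Equiv.Perm (Fin 3)),
      f.map (Int.castRingHom L) = (X - C (r 0)) * (X - C (r 1)) * (X - C (r 2)) ∧
      (∀ g i, g (r i) = r (φ g i)) ∧ Set.InjOn φ (K.relativeFixingSubgroup L) := by
  subst hFy
  have hyL : y ∈ L := by
    refine hFL ?_
    rw [normalClosure_adjoin_simple]
    exact le_iSup (fun σ : E ≃ₐ[ℚ] E ↦ ℚ⟮σ y⟯) 1 (mem_adjoin_simple_self ℚ y)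
  have hyint : IsIntegral ℚ y := Algebra.IsIntegral.isIntegral y
  have hmin : (minpoly ℚ (⟨y, hyL⟩ : L)).natDegree = 3 := by
    rw [← hdeg, adjoin.finrank hyint]
    congr 1
    exact (minpoly.algebraMap_eq (algebraMap L E).injective (⟨y, hyL⟩ : L)).symm
  have hyf : aeval (⟨y, hyL⟩ : L) f = 0 := by
    refine (algebraMap L E).injective ?_
    rw [map_zero, ← hy, aeval_def, aeval_def, hom_eval₂]
    congr 1
  obtain ⟨r, hr, hmap⟩ := exists_roots_of_natDegree_eq_three hf hf3 hyf hmin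
  obtain ⟨φ, hφ⟩ := exists_permHom_of_forall_exists_apply_eq hr (exists_apply_eq_of_map_eq hmap)
  refine ⟨r, φ, hmap, hφ, fun g hg h hh hgh ↦ ?_⟩
  refine inv_mul_eq_one.mp (AlgEquiv.eq_one_of_le_fixedFieldLift (hL.trans (sup_le
    (AlgEquiv.le_fixedFieldLift_of_mem_relativeFixingSubgroup hKL (mul_mem (inv_mem hg) hh)) ?_)))
  have hfix (i : Fin 3) : (g⁻¹ * h) (r i) = r i := by
    rw [hφ, map_mul, map_inv, hgh, inv_mul_cancel, Equiv.Perm.one_apply]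
  rw [normalClosure_adjoin_simple]
  refine iSup_le fun σ ↦ adjoin_simple_le_iff.mpr ?_
  have hroot : (f.map (Int.castRingHom E)).eval (σ y) = 0 := by
    have h1 := congrArg σ hy
    rw [map_zero, aeval_def] at h1
    rw [eval_map, ← h1]
    have h2 := hom_eval₂ f (algebraMap ℤ E) (σ : E →+* E) y
    rw [show (σ : E →+* E).comp (algebraMap ℤ E) = Int.castRingHom E from RingHom.ext_int _ _]
      at h2
    exact h2.symm
  have hmapE : f.map (Int.castRingHom E) = (f.map (Int.castRingHom L)).map (algebraMap L E) := by
    rw [Polynomial.map_map]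
    congr 1
  rw [hmapE, hmap] at hroot
  simp only [Polynomial.map_mul, Polynomial.map_sub, map_X, map_C, eval_mul, eval_sub, eval_X,
    eval_C, mul_eq_zero, sub_eq_zero] at hroot
  rcases hroot with (h | h) | h <;> rw [h] <;>
    exact AlgEquiv.coe_mem_fixedFieldLift.mpr (hfix _)

end Tower

instance AlgebraicClosure.isAlgebraic_rat : Algebra.IsAlgebraic ℚ (AlgebraicClosure ℚ) :=
  AlgebraicClosure.isAlgebraic ℚ

lemma NumberField.absMulHeight₁_nonneg {K : Type*} [Field K] [CharZero K] (x : K) :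
    0 ≤ absMulHeight₁ x := by
  rw [absMulHeight₁]
  split_ifs with hx
  · have : FiniteDimensional ℚ ℚ⟮x⟯ := adjoin.finiteDimensional hx
    have : NumberField ℚ⟮x⟯ := {}
    exact Real.rpow_nonneg (Height.mulHeight₁_nonneg _) _
  · exact zero_le_one

/-! ### The height bound for one step of the tower -/

namespace NumberField

variable {K L F : IntermediateField ℚ (AlgebraicClosure ℚ)} [NumberField L] [NumberField F]
  {p : ℕ}

lemma normalClosure_le_fixedFieldLift_of_not_dvd_discr (hp : p.Prime) {P : Ideal (𝓞 L)}
    (hP : P.IsPrime) (hpP : (p : 𝓞 L) ∈ P) (hFL : normalClosure ℚ F (AlgebraicClosure ℚ) ≤ L)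
    (hdvd : ¬ (p : ℤ) ∣ discr F) {g : L ≃ₐ[ℚ] L} (hg : g ∈ P.inertia (L ≃ₐ[ℚ] L)) :
    normalClosure ℚ F (AlgebraicClosure ℚ) ≤ g.fixedFieldLift := by
  have hF := normalClosure_le_iff.mp hFL
  refine normalClosure_le_iff.mpr fun f ↦ ?_
  rintro _ ⟨x, rfl⟩
  let f' : F →ₐ[ℚ] L := f.codRestrict L.toSubalgebra fun x ↦ hF f ⟨x, rfl⟩
  have h1 := inertia_apply_eq_self_of_not_dvd_discr L hp hP hpP F hF hdvd hg f' x
  exact AlgEquiv.coe_mem_fixedFieldLift.mpr h1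

/-- The generator `y = α / c` is a root of `y³ + a₀ c y + b₀` or `y³ + a₀ c² y² + b₀²`, where the
gcd condition keeps `p` from dividing both lower coefficients. -/
lemma exists_generator_of_isOsadaTrinomialType (hF : IsOsadaTrinomialType F) (hp : p.Prime) :
    ∃ (y : AlgebraicClosure ℚ) (f : ℤ[X]), F = ℚ⟮y⟯ ∧ f.Monic ∧ f.natDegree = 3 ∧
      aeval y f = 0 ∧ (f.coeff 1 = 0 ∨ f.coeff 2 = 0) ∧
      ¬ ((p : ℤ) ∣ f.coeff 0 ∧ (p : ℤ) ∣ f.coeff 1 ∧ (p : ℤ) ∣ f.coeff 2) := by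
  obtain ⟨α, a₀, b₀, c, l, rfl, hl, hgcd, hα⟩ := hF
  -- For `c = 0` the gcd would be `|3 * b₀|`, which is never 1.
  have hc : c ≠ 0 := by
    rintro rfl
    have h3 : (3 * b₀).natAbs = 1 := by simpa using hgcd
    omega
  have hcE : (c : AlgebraicClosure ℚ) ≠ 0 := by exact_mod_cast hc
  have hcop : ¬ ((p : ℤ) ∣ b₀ ∧ (p : ℤ) ∣ a₀ * c) := by
    rintro ⟨hb, hac⟩
    have : (p : ℤ) ∣ (Int.gcd (2 * a₀ * c) (3 * b₀) : ℤ) :=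
      Int.dvd_coe_gcd (by rw [mul_assoc]; exact hac.mul_left 2) (hb.mul_left 3)
    rw [hgcd] at this
    exact hp.one_lt.ne' (by exact_mod_cast Int.eq_one_of_dvd_one (by positivity) this)
  have hpi := Nat.prime_iff_prime_int.mp hp
  have hgen : ℚ⟮α⟯ = ℚ⟮α / (c : AlgebraicClosure ℚ)⟯ := by
    refine le_antisymm (adjoin_simple_le_iff.mpr ?_) (adjoin_simple_le_iff.mpr ?_)
    · have := mul_mem (mem_adjoin_simple_self ℚ (α / (c : AlgebraicClosure ℚ)))
        (intCast_mem ℚ⟮α / (c : AlgebraicClosure ℚ)⟯ c)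
      rwa [div_mul_cancel₀ _ hcE] at this
    · exact div_mem (mem_adjoin_simple_self ℚ α) (intCast_mem _ c)
  obtain ⟨y, hy⟩ : ∃ y, α = y * (c : AlgebraicClosure ℚ) :=
    ⟨α / c, (div_mul_cancel₀ _ hcE).symm⟩
  have hcoeff₁ (a b : ℤ) : (X ^ 3 + C a * X + C b).coeff 0 = b ∧
      (X ^ 3 + C a * X + C b).coeff 1 = a ∧ (X ^ 3 + C a * X + C b).coeff 2 = 0 := by
    simp [-eq_intCast, coeff_X, coeff_C]
  have hcoeff₂ (a b : ℤ) : (X ^ 3 + C a * X ^ 2 + C b).coeff 0 = b ∧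
      (X ^ 3 + C a * X ^ 2 + C b).coeff 1 = 0 ∧ (X ^ 3 + C a * X ^ 2 + C b).coeff 2 = a := by
    simp [-eq_intCast, coeff_C]
  have hc3 : (c : AlgebraicClosure ℚ) ^ 3 ≠ 0 := pow_ne_zero 3 hcE
  rcases hl with rfl | rfl
  · refine ⟨α / c, X ^ 3 + C (a₀ * c) * X + C b₀, hgen, by monicity!, by compute_degree!, ?_, ?_,
      ?_⟩
    · rw [hy] at hα ⊢
      rw [mul_div_cancel_right₀ _ hcE]
      simp at hα ⊢
      refine (mul_eq_zero.mp (?_ : (c : AlgebraicClosure ℚ) ^ 3 * _ = 0)).resolve_left hc3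
      linear_combination hα
    · exact .inr (hcoeff₁ _ _).2.2
    · rw [(hcoeff₁ _ _).1, (hcoeff₁ _ _).2.1]
      exact fun h ↦ hcop ⟨h.1, h.2.1⟩
  · refine ⟨α / c, X ^ 3 + C (a₀ * c ^ 2) * X ^ 2 + C (b₀ ^ 2), hgen, by monicity!,
      by compute_degree!, ?_, ?_, ?_⟩
    · rw [hy] at hα ⊢
      rw [mul_div_cancel_right₀ _ hcE]
      simp at hα ⊢
      refine (mul_eq_zero.mp (?_ : (c : AlgebraicClosure ℚ) ^ 3 * _ = 0)).resolve_left hc3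
      linear_combination hα
    · exact .inl (hcoeff₂ _ _).2.1
    · rw [(hcoeff₂ _ _).1, (hcoeff₂ _ _).2.2]
      rintro ⟨h0, -, h2⟩
      refine hcop ⟨hpi.dvd_of_dvd_pow h0, hpi.dvd_of_dvd_pow (n := 2) ?_⟩
      rw [mul_pow, sq a₀, mul_assoc]
      exact h2.mul_left a₀

variable [IsGalois ℚ L]

/-- Each of the four conditions on `F` forces the inertia groups above `p` to normally generate
the Galois group of the extension `L / K` obtained by adjoining the conjugates of `F`. -/
lemma inertia_normallyGenerates (hKL : K ≤ L)
    (hFL : normalClosure ℚ F (AlgebraicClosure ℚ) ≤ L)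
    (hL : L ≤ K ⊔ normalClosure ℚ F (AlgebraicClosure ℚ)) (hdeg : Module.finrank ℚ F ≤ 3)
    (hp : p.Prime) (hp3 : p ≠ 3) (hdvd : (p : ℤ) ∣ discr F)
    {z : AlgebraicClosure ℚ} (hz : z ^ 2 + z + 1 = 0) (hzK : z ∈ K)
    (hI : ∀ P : Ideal (𝓞 L), P.IsPrime → (p : 𝓞 L) ∈ P →
      P.inertia (L ≃ₐ[ℚ] L) ≤ K.relativeFixingSubgroup L)
    (hF : IsGalois ℚ F ∨ IsPureCubicType F ∨ HasOddDiscrGenerator F p ∨ IsOsadaTrinomialType F) :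
    Nat.card (K.relativeFixingSubgroup L) ≤ 6 ∧
      ∀ P : Ideal (𝓞 L), P.IsPrime → (p : 𝓞 L) ∈ P →
        (P.inertia (L ≃ₐ[ℚ] L)).NormallyGenerates (K.relativeFixingSubgroup L) := by
  have hFle : F ≤ normalClosure ℚ F (AlgebraicClosure ℚ) := le_normalClosure F
  have hFL' : F ≤ L := hFle.trans hFL
  have hbot (P : Ideal (𝓞 L)) (hP : P.IsPrime) (hpP : (p : 𝓞 L) ∈ P) :
      P.inertia (L ≃ₐ[ℚ] L) ≠ ⊥ := by
    let := (inclusion hFL').toRingHom.toAlgebra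
    exact inertia_ne_bot_of_dvd_discr hp hP hpP F hdvd
  have hthree (hLF : L ≤ K ⊔ F) : Nat.card (K.relativeFixingSubgroup L) ≤ 6 ∧
      ∀ P : Ideal (𝓞 L), P.IsPrime → (p : 𝓞 L) ∈ P →
        (P.inertia (L ≃ₐ[ℚ] L)).NormallyGenerates (K.relativeFixingSubgroup L) := by
    have hcard := card_relativeFixingSubgroup_le_three hKL hFL' hLF hdeg
    exact ⟨by omega, fun P hP hpP ↦
      Subgroup.normallyGenerates_of_card_le_three (hI P hP hpP) (hbot P hP hpP) hcard⟩
  have hgal (hG : IsGalois ℚ F) : L ≤ K ⊔ F := by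
    have : normalClosure ℚ F (AlgebraicClosure ℚ) = F := by
      have : @Normal ℚ F _ _ F.algebra' := hG.to_normal
      exact normalClosure_of_normal F
    rwa [this] at hL
  have hsix {y : AlgebraicClosure ℚ} (hFy : F = ℚ⟮y⟯) (h3 : Module.finrank ℚ F = 3) {f : ℤ[X]}
      (hf : f.Monic) (hf3 : f.natDegree = 3) (hy : aeval y f = 0)
      (hodd : ∀ (r : Fin 3 → L) (φ : (L ≃ₐ[ℚ] L) →* Equiv.Perm (Fin 3)),
        f.map (Int.castRingHom L) = (X - C (r 0)) * (X - C (r 1)) * (X - C (r 2)) →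
        (∀ g i, g (r i) = r (φ g i)) → Set.InjOn φ (K.relativeFixingSubgroup L) →
        ∀ P : Ideal (𝓞 L), P.IsPrime → (p : 𝓞 L) ∈ P →
          ∃ σ ∈ P.inertia (L ≃ₐ[ℚ] L), (φ σ).sign = -1) :
      Nat.card (K.relativeFixingSubgroup L) ≤ 6 ∧
      ∀ P : Ideal (𝓞 L), P.IsPrime → (p : 𝓞 L) ∈ P →
        (P.inertia (L ≃ₐ[ℚ] L)).NormallyGenerates (K.relativeFixingSubgroup L) := by
    obtain ⟨r, φ, hmap, hr, hφ⟩ := exists_permHom_of_cubic hKL hFL hL hFy h3 hf hf3 hy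
    refine ⟨?_, fun P hP hpP ↦ ?_⟩
    · have := Nat.card_le_card_of_injective
        (fun h : K.relativeFixingSubgroup L ↦ φ h) (fun a b h ↦ Subtype.ext (hφ a.2 b.2 h))
      rwa [Nat.card_perm, Nat.card_fin] at this
    · obtain ⟨σ, hσ, hsign⟩ := hodd r φ hmap hr hφ P hP hpP
      exact Subgroup.normallyGenerates_of_odd φ hφ (hI P hP hpP) hσ hsign
  -- Fields of degree at most 2 are Galois whichever condition is assumed, so (b)-(d) matter only
  -- for genuine cubics.
  rcases lt_or_eq_of_le hdeg with hlt | h3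
  · exact hthree (hgal (isGalois_of_finrank_le_two (by omega)))
  rcases hF with hG | ⟨β, hFβ, q, hq⟩ | ⟨α, hint, hFα, hodd⟩ | hO
  · exact hthree (hgal hG)
  · refine hthree (hL.trans (sup_le le_sup_left ?_))
    subst hFβ
    exact normalClosure_adjoin_le_of_pow_three_eq hz hzK hq
  · have hf := minpoly.monic hint
    have hf3 : (minpoly ℤ α).natDegree = 3 := by
      have hq : IsIntegral ℚ α := Algebra.IsIntegral.isIntegral α
      rw [← h3, hFα, adjoin.finrank hq, minpoly.isIntegrallyClosed_eq_field_fractions' ℚ hint,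
        hf.natDegree_map]
    exact hsix hFα h3 hf hf3 (minpoly.aeval ℤ α) fun r φ hmap hr hφ P hP hpP ↦
      exists_odd_of_odd_padicValInt_discr hp hP hpP hf hf3 hmap hφ (hI P hP hpP) hodd
  · obtain ⟨y, f, hFy, hf, hf3, hy, hzero, hcop⟩ :=
      exists_generator_of_isOsadaTrinomialType hO hp
    exact hsix hFy h3 hf hf3 hy fun r φ hmap hr hφ P hP hpP ↦
      exists_odd_of_not_dvd_coeff hp hp3 hP hpP hf hmap hr hφ (hI P hP hpP) (hbot P hP hpP)
        hzero hcop

/-- Lower bound for the height of an element of `L` outside `K`. -/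
lemma le_absMulHeight₁_of_notMem (hKL : K ≤ L)
    (hFL : normalClosure ℚ F (AlgebraicClosure ℚ) ≤ L)
    (hL : L ≤ K ⊔ normalClosure ℚ F (AlgebraicClosure ℚ)) (hdeg : Module.finrank ℚ F ≤ 3)
    (hp : p.Prime) (hp3 : p ≠ 3) (hdvd : (p : ℤ) ∣ discr F)
    {z : AlgebraicClosure ℚ} (hz : z ^ 2 + z + 1 = 0) (hzK : z ∈ K)
    (hI : ∀ P : Ideal (𝓞 L), P.IsPrime → (p : 𝓞 L) ∈ P →
      ∀ g ∈ P.inertia (L ≃ₐ[ℚ] L), K ≤ g.fixedFieldLift)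
    (hF : IsGalois ℚ F ∨ IsPureCubicType F ∨ HasOddDiscrGenerator F p ∨ IsOsadaTrinomialType F)
    {α : AlgebraicClosure ℚ} (hαL : α ∈ L) (hαK : α ∉ K) :
    (p : ℝ) ≤ (2 * absMulHeight₁ α ^ 2) ^ 216 := by
  have hI' (P : Ideal (𝓞 L)) (hP : P.IsPrime) (hpP : (p : 𝓞 L) ∈ P) :
      P.inertia (L ≃ₐ[ℚ] L) ≤ K.relativeFixingSubgroup L := fun g hg ↦
    mem_relativeFixingSubgroup.mpr fun _ hx ↦
      AlgEquiv.coe_mem_fixedFieldLift.mp (hI P hP hpP g hg hx)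
  obtain ⟨hcard, hgen⟩ :=
    inertia_normallyGenerates hKL hFL hL hdeg hp hp3 hdvd hz hzK hI' hF
  have key := pow_finrank_le_of_inertia_normallyGenerates (L := L) hcard hp.ne_zero
    (fun P hP hpP ↦ ⟨hI' P hP hpP, hgen P hP hpP, natCast_notMem_pow_of_card_inertia_lt hp hP hpP
      (((Subgroup.card_le_of_le (hI' P hP hpP)).trans hcard).trans_lt (by norm_num))⟩)
    (exists_apply_ne_of_notMem (x := ⟨α, hαL⟩) hαK)
  have hh : absMulHeight₁ α ^ Module.finrank ℚ L = Height.mulHeight₁ (⟨α, hαL⟩ : L) :=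
    absMulHeight₁_pow_finrank L ⟨α, hαL⟩
  -- Both sides become `[L : ℚ]`-th powers; the root gives a bound independent of the layer.
  rw [← hh, ← pow_mul, mul_comm _ 2, pow_mul, ← mul_pow, ← pow_mul, mul_comm _ 216, pow_mul] at key
  exact (pow_le_pow_iff_left₀ (by positivity) (by positivity) Module.finrank_pos.ne').mp key

end NumberField

/-! ### The tower of composita -/

section NormalTower

variable {k E : Type*} [Field k] [Field E] [Algebra k E]

/-- The tower of composita of the normal closures of a sequence of subfields. -/
noncomputable def IntermediateField.normalTower (G : ℕ → IntermediateField k E) :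
    ℕ → IntermediateField k E
  | 0 => normalClosure k (G 0) E
  | n + 1 => normalTower G n ⊔ normalClosure k (G (n + 1)) E

variable (G : ℕ → IntermediateField k E)

lemma IntermediateField.normalTower_mono : Monotone (normalTower G) :=
  monotone_nat_of_le_succ fun _ ↦ le_sup_left

lemma IntermediateField.normalClosure_le_normalTower (n : ℕ) :
    normalClosure k (G n) E ≤ normalTower G n := by
  cases n with
  | zero => exact le_rfl
  | succ n => exact le_sup_right

instance IntermediateField.finiteDimensional_normalTower [∀ n, FiniteDimensional k (G n)] (n : ℕ) :
    FiniteDimensional k (normalTower G n) := by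
  induction n with
  | zero => exact normalClosure.is_finiteDimensional k (G 0) E
  | succ n ih =>
    have := normalClosure.is_finiteDimensional k (G (n + 1)) E
    exact finiteDimensional_sup _ _

instance IntermediateField.normal_normalTower [Normal k E] (n : ℕ) :
    Normal k (normalTower G n) := by
  induction n with
  | zero => exact normalClosure.normal k (G 0) E
  | succ n ih =>
    have := normalClosure.normal k (G (n + 1)) E
    exact normal_sup k E _ _

end NormalTower

/-! ### Northcott property of the tower -/

namespace NumberField

lemma normalTower_le_fixedFieldLift {G : ℕ → IntermediateField ℚ (AlgebraicClosure ℚ)}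
    [∀ n, NumberField (G n)] {L : IntermediateField ℚ (AlgebraicClosure ℚ)} [NumberField L] {p : ℕ}
    (hp : p.Prime) {P : Ideal (𝓞 L)} (hP : P.IsPrime) (hpP : (p : 𝓞 L) ∈ P) {n : ℕ}
    (hL : normalTower G n ≤ L) (hdvd : ∀ m ≤ n, ¬ (p : ℤ) ∣ discr (G m)) {g : L ≃ₐ[ℚ] L}
    (hg : g ∈ P.inertia (L ≃ₐ[ℚ] L)) : normalTower G n ≤ g.fixedFieldLift := by
  induction n with
  | zero =>
    exact normalClosure_le_fixedFieldLift_of_not_dvd_discr hp hP hpP hL (hdvd 0 le_rfl) hg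
  | succ n ih =>
    exact sup_le (ih (le_sup_left.trans hL) fun m hm ↦ hdvd m (hm.trans n.le_succ))
      (normalClosure_le_fixedFieldLift_of_not_dvd_discr hp hP hpP (le_sup_right.trans hL)
        (hdvd _ le_rfl) hg)

/-- Bounded height elements of the union of a tower of number fields are in one of the layers, if
this holds for each step far up in the tower. -/
lemma hasNorthcottProperty_of_tower {T : ℕ → IntermediateField ℚ (AlgebraicClosure ℚ)}
    [∀ n, NumberField (T n)] {A : Set (AlgebraicClosure ℚ)} (hA : ∀ α ∈ A, ∃ n, α ∈ T n)
    (hT : Monotone T)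
    (hstep : ∀ X : ℝ, ∃ N, ∀ n ≥ N, ∀ α ∈ T (n + 1), absMulHeight₁ α ≤ X → α ∈ T n) :
    HasNorthcottProperty A := by
  refine ⟨fun X ↦ ?_⟩
  obtain ⟨N, hN⟩ := hstep X
  have hmem (α : AlgebraicClosure ℚ) (hα : α ∈ A) (hX : absMulHeight₁ α ≤ X) : α ∈ T N := by
    obtain ⟨m, hm⟩ := hA α hα
    -- Bounded height lets `α` descend one layer at a time down to `T N`.
    have hdown (k : ℕ) : α ∈ T (N + k) → α ∈ T N := by
      induction k with
      | zero => exact id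
      | succ k ih => exact fun h ↦ ih (hN (N + k) (Nat.le_add_right _ _) α h hX)
    exact hdown m (hT (Nat.le_add_left m N) hm)
  have hfin : ((fun x : T N ↦ (x : AlgebraicClosure ℚ)) ''
      {x | Height.mulHeight₁ x ≤ X ^ Module.finrank ℚ (T N)}).Finite :=
    (finite_setOfPred_mulHeight₁_le (T N) _).image _
  refine Set.Finite.of_finite_image (hfin.subset ?_) Subtype.val_injective.injOn
  rintro _ ⟨⟨α, hα⟩, hX, rfl⟩
  refine ⟨⟨α, hmem α hα hX⟩, ?_, rfl⟩
  rw [Set.mem_ofPred_eq, ← absMulHeight₁_pow_finrank]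
  exact pow_le_pow_left₀ (absMulHeight₁_nonneg _) hX _

end NumberField

theorem corollary1p9
    (F : ℕ+ → IntermediateField ℚ (AlgebraicClosure ℚ)) [∀ i, NumberField (F i)]
    (hdeg : ∀ i, Module.finrank ℚ (F i) ≤ 3)
    (p : ℕ+ → ℕ)
    (hp : ∀ i, 1 < i → (p i).Prime)
    (hram : ∀ i, 1 < i → (p i : ℤ) ∣ NumberField.discr (F i))
    (hnew : ∀ i, 1 < i → ∀ j, j < i → ¬ (p i : ℤ) ∣ NumberField.discr (F j))
    (hF : ∀ i, 1 < i →
      IsGalois ℚ (F i) ∨ IsPureCubicType (F i) ∨ HasOddDiscrGenerator (F i) (p i) ∨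
        IsOsadaTrinomialType (F i)) :
    HasNorthcottProperty
      ((⨆ i, normalClosure ℚ (F i) (AlgebraicClosure ℚ) :
        IntermediateField ℚ (AlgebraicClosure ℚ)) : Set (AlgebraicClosure ℚ)) := by
  classical
  -- Adjoining `ζ₃` at the bottom only enlarges the set to be treated, and it makes pure cubic steps
  -- normal.
  obtain ⟨z, hz⟩ : ∃ z : AlgebraicClosure ℚ, z ^ 2 + z + 1 = 0 := by
    obtain ⟨z, hz⟩ := IsAlgClosed.exists_root (X ^ 2 + X + 1 : (AlgebraicClosure ℚ)[X]) (by
      rw [show (X ^ 2 + X + 1 : (AlgebraicClosure ℚ)[X]).degree = 2 by compute_degree!]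
      norm_num)
    exact ⟨z, by simpa using hz⟩
  let G : ℕ → IntermediateField ℚ (AlgebraicClosure ℚ)
    | 0 => ℚ⟮z⟯
    | n + 1 => F n.succPNat
  have hG0 : NumberField (G 0) :=
    { to_finiteDimensional := adjoin.finiteDimensional (Algebra.IsIntegral.isIntegral z) }
  have hG : ∀ n, NumberField (G n)
    | 0 => hG0
    | n + 1 => inferInstanceAs (NumberField (F n.succPNat))
  have hnormal : Normal ℚ (AlgebraicClosure ℚ) := normal_iff.mpr fun x ↦
    ⟨Algebra.IsIntegral.isIntegral x, IsAlgClosed.splits _⟩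
  have hT (n : ℕ) : NumberField (normalTower G n) :=
    { to_finiteDimensional := finiteDimensional_normalTower G n }
  have hTG (n : ℕ) : IsGalois ℚ (normalTower G n) :=
    { to_normal := normal_normalTower G n }
  refine NumberField.hasNorthcottProperty_of_tower (T := normalTower G) (fun α hα ↦ ?_)
    (normalTower_mono G) fun X ↦ ?_
  · have hle : (⨆ i, normalClosure ℚ (F i) (AlgebraicClosure ℚ)) ≤ ⨆ n, normalTower G n := by
      refine iSup_le fun i ↦ le_trans ?_ (le_iSup (normalTower G) (i.natPred + 1))
      have := normalClosure_le_normalTower G (i.natPred + 1)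
      rwa [show G (i.natPred + 1) = F i from congrArg F (PNat.succPNat_natPred i)] at this
    have hα' := hle hα
    rw [← SetLike.mem_coe, coe_iSup_of_directed (normalTower_mono G).directed_le] at hα'
    exact Set.mem_iUnion.mp hα'
  · let B : ℕ := max (max ⌈(2 * X ^ 2) ^ 216⌉₊ 3) (NumberField.discr (G 0)).natAbs
    have hinj : Set.InjOn p {i | 1 < i} := by
      intro i hi j hj hij
      rcases lt_trichotomy i j with h | h | h
      · exact absurd (hij ▸ hram i hi) (hnew j hj i h)
      · exact h
      · exact absurd (hij ▸ hram j hj) (hnew i hi j h)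
    have hfin : {i : ℕ+ | 1 < i ∧ p i ≤ B}.Finite :=
      Set.Finite.of_finite_image ((Set.finite_Iic B).subset (by
        rintro _ ⟨i, hi, rfl⟩
        exact hi.2)) (hinj.mono fun i hi ↦ hi.1)
    obtain ⟨M, hM⟩ := hfin.bddAbove
    -- As `M` is a positive natural number, `n ≥ M` makes the index `n + 1` of the added field
    -- exceed 1, where the ramification hypotheses hold.
    refine ⟨M, fun n hn α hα hX ↦ ?_⟩
    by_contra hαn
    have hMn : M < n.succPNat := by
      rw [← PNat.coe_lt_coe, Nat.succPNat_coe]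
      omega
    have h1 : 1 < n.succPNat := lt_of_le_of_lt one_le hMn
    have hB : B < p n.succPNat := by
      by_contra! hle
      exact hMn.not_ge (hM ⟨h1, hle⟩)
    have hprime := hp _ h1
    have hp3 : p n.succPNat ≠ 3 := by
      have : 3 ≤ B := (le_max_right _ _).trans (le_max_left _ _)
      omega
    have hndvd (m : ℕ) (hm : m ≤ n) : ¬ (p n.succPNat : ℤ) ∣ NumberField.discr (G m) := by
      cases m with
      | zero =>
        intro hdvd
        have h2 := Nat.le_of_dvd (Int.natAbs_pos.mpr (NumberField.discr_ne_zero (G 0)))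
          (Int.natCast_dvd.mp hdvd)
        have : (NumberField.discr (G 0)).natAbs ≤ B := le_max_right _ _
        omega
      | succ m =>
        refine hnew _ h1 m.succPNat ?_
        rw [← PNat.coe_lt_coe, Nat.succPNat_coe, Nat.succPNat_coe]
        omega
    have hzT : z ∈ normalTower G n := normalTower_mono G n.zero_le
      (le_normalClosure ℚ⟮z⟯ (mem_adjoin_simple_self ℚ z))
    have hbound := NumberField.le_absMulHeight₁_of_notMem (K := normalTower G n)
      (L := normalTower G (n + 1)) (F := F n.succPNat) le_sup_left le_sup_right le_rfl (hdeg _)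
      hprime hp3 (hram _ h1) hz hzT
      (fun P hP hpP g hg ↦ NumberField.normalTower_le_fixedFieldLift hprime hP hpP
        (normalTower_mono G n.le_succ) hndvd hg) (hF _ h1) hα hαn
    have h0 := NumberField.absMulHeight₁_nonneg α
    have hBX : (2 * X ^ 2) ^ 216 ≤ (B : ℝ) := (Nat.le_ceil _).trans
      (by exact_mod_cast (le_max_left _ _).trans (le_max_left _ _))
    have hlt : (B : ℝ) < p n.succPNat := by exact_mod_cast hB
    have hmono : (2 * NumberField.absMulHeight₁ α ^ 2) ^ 216 ≤ (2 * X ^ 2) ^ 216 := by gcongr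
    linarith
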